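/- **Conventions.** A *n.n.H. (not necessarily Hausdorff) Banach manifold* is a set with a $C^\infty$-atlas with values in real Banach spaces, which may vary from chart to chart; it need not be Hausdorff, and is called a *Banach manifold* if it is. A *submersion* is a surjective smooth map whose tangent maps are all surjective with split kernels. A *n.n.H. Banach-Lie groupoid* $\mathcal G\rightrightarrows M$ is a topological groupoid (source $\mathbf s$ and target $\mathbf t$ continuous, open and surjective; continuous multiplication $(g,h)\mapsto gh$, defined when $\mathbf s(g)=\mathbf t(h)$; identity section $\mathbf 1\colon M\to\mathcal G$ a topological embedding; inversion a homeomorphism) such that $\mathcal G$ is a n.n.H. Banach manifold, $M$ is a (Hausdorff) Banach manifold, $\mathbf s$ is a submersion, and inversion and multiplication are smooth. A *Lie bracket* on an anchored Banach bundle $(\mathcal A,\rho)$ over $M$ (a Banach vector bundle $\mathcal A\to M$ with a smooth bundle morphism $\rho\colon\mathcal A\to TM$ over $\mathrm{id}_M$) is a skew-symmetric $\mathbb R$-bilinear map $[\cdot,\cdot]$ on the space $\Gamma(\mathcal A)$ of smooth sections that satisfies the Jacobi identity and the Leibniz rule $[\sigma,f\tau]=f[\sigma,\tau]+df(\rho(\sigma))\,\tau$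 for $f\in C^\infty(M)$. It is *localizable* if for every open $U\subseteq M$ there is a Lie bracket $[\cdot,\cdot]_U$ on $(\mathcal A|_U,\rho|_U)$ such that $[\cdot,\cdot]_M=[\cdot,\cdot]$ and $[\sigma|_V,\tau|_V]_V=([\sigma,\tau]_U)|_V$ for all open $V\subseteq U\subseteq M$ and $\sigma,\tau\in\Gamma(\mathcal A|_U)$. $(\mathcal A,M,\rho,[\cdot,\cdot])$ is a *Banach-Lie algebroid* if $[\cdot,\cdot]$ is a localizable Lie bracket and $\rho([\sigma,\tau])=[\rho(\sigma),\rho(\tau)]$ for all $\sigma,\tau\in\Gamma(\mathcal A)$. For $U\subseteq M$ open, a vector field $X$ on $\mathbf t^{-1}(U)$ is *right-invariant* if it is smooth, $T\mathbf s(X_h)=0$ for all $h\in\mathbf t^{-1}(U)$, and $X_{hg}=T_h(R_g)X_h$ for all $h\in\mathbf t^{-1}(U)$ and $g\in\mathcal G$ with $\mathbf s(h)=\mathbf t(g)$, where $R_g\colon\mathbf s^{-1}(\mathbf t(g))\to\mathbf s^{-1}(\mathbf s(g))$, $k\mapsto kg$. **Theorem.** Let $\mathcal G\rightrightarrows M$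 be a n.n.H. Banach-Lie groupoid. 1. The pullback $\mathcal{AG}=\mathbf 1^*(\ker T\mathbf s)$, with fibres $\mathcal{AG}_x=\ker T_{\mathbf 1_x}\mathbf s$, is a Banach vector bundle over $M$, for which the inclusions of the fibres form a smooth bundle morphism $\mathcal{AG}\to T\mathcal G$ covering $\mathbf 1$. 2. For every open $U\subseteq M$ every $X\in\Gamma(\mathcal{AG}|_U)$ has a unique right-invariant extension $\widetilde X$ to $\mathbf t^{-1}(U)$, that is, $\widetilde X_{\mathbf 1_x}=X_x$ for $x\in U$, and $X\mapsto\widetilde X$ is a linear isomorphism of $\Gamma(\mathcal{AG}|_U)$ onto the space of right-invariant vector fields on $\mathbf t^{-1}(U)$. There are unique bilinear brackets $[\cdot,\cdot]_U$ on the spaces $\Gamma(\mathcal{AG}|_U)$, $U\subseteq M$ open, with $\widetilde{[X,Y]_U}=[\widetilde X,\widetilde Y]$, the Lie bracket of vector fields. 3. Put $\rho_x:=T_{\mathbf 1_x}\mathbf t|_{\mathcal{AG}_x}\colon\mathcal{AG}_x\to T_xM$ and $[\cdot,\cdot]:=[\cdot,\cdot]_M$. Then $(\mathcal{AG},M,\rho,[\cdot,\cdot])$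 is a Banach-Lie algebroid. Moreover, the brackets $[\cdot,\cdot]_U$ are Lie brackets on the restrictions $(\mathcal{AG}|_U,\rho|_U)$ that localize $[\cdot,\cdot]$, and $\rho([X,Y]_U)=[\rho(X),\rho(Y)]$ for all open $U\subseteq M$ and $X,Y\in\Gamma(\mathcal{AG}|_U)$. -/

import Mathlib

open Set Topology TopologicalSpace
open scoped ContDiff

universe u v u' v' w w'

noncomputable section

/-! ## Banach manifolds, not necessarily Hausdorff and not necessarily pure -/

/-- A smooth manifold modelled on real Banach spaces, not necessarily Hausdorff.  The model space is
allowed to vary from point to point: from a smooth atlas one keeps, for each point `x`, one chart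
`chart x` defined around `x`, with values in the Banach space `Model x`; these charts still form
an atlas, with smooth transition maps in both directions. -/
structure NNHBanachManifold where
  carrier : Type u
  [topology : TopologicalSpace carrier]
  Model : carrier → Type v
  [normedAddCommGroup : ∀ x, NormedAddCommGroup (Model x)]
  [normedSpace : ∀ x, NormedSpace ℝ (Model x)]
  [completeSpace : ∀ x, CompleteSpace (Model x)]
  chart : ∀ x, OpenPartialHomeomorph carrier (Model x)
  mem_chart_source : ∀ x, x ∈ (chart x).source
  smooth_transition : ∀ x y,
    ContDiffOn ℝ ∞ (chart y ∘ (chart x).symm) ((chart x).symm.trans (chart y)).source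

attribute [instance] NNHBanachManifold.topology NNHBanachManifold.normedAddCommGroup
  NNHBanachManifold.normedSpace NNHBanachManifold.completeSpace

instance : CoeSort NNHBanachManifold.{u, v} (Type u) := ⟨NNHBanachManifold.carrier⟩

namespace NNHBanachManifold

variable (M : NNHBanachManifold.{u, v}) (N : NNHBanachManifold.{u', v'})

/-- The tangent space at `x`; a tangent vector is represented by its principal part in the
chart `chart x`. -/
abbrev TangentSp (x : M) : Type v := M.Model x

variable {M N}

/-- Smoothness at `x` of a map with values in a normed space. -/
def SmoothFunAt {F : Type w} [NormedAddCommGroup F] [NormedSpace ℝ F] (f : M → F) (x : M) : Prop :=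
  ContDiffAt ℝ ∞ (f ∘ (M.chart x).symm) (M.chart x x)

/-- Smoothness of a map between manifolds. -/
def Smooth (f : M → N) : Prop :=
  Continuous f ∧
    ∀ x, ContDiffAt ℝ ∞ (N.chart (f x) ∘ f ∘ (M.chart x).symm) (M.chart x x)

/-- The tangent map `T_x f : T_x M → T_y N`, where `y = f x`. -/
def tanMap (f : M → N) {x : M} {y : N} (_hxy : f x = y) : M.TangentSp x →L[ℝ] N.TangentSp y :=
  fderiv ℝ (N.chart y ∘ f ∘ (M.chart x).symm) (M.chart x x)

/-- The tangent map at `x ∈ S` of a map that is only relevant on a submanifold `S`.  It is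
meaningful on vectors tangent to `S`. -/
def tanMapWithin (f : M → N) (S : Set M) (x : M) : M.TangentSp x →L[ℝ] N.TangentSp (f x) :=
  fderivWithin ℝ (N.chart (f x) ∘ f ∘ (M.chart x).symm)
    ((M.chart x).target ∩ (M.chart x).symm ⁻¹' S) (M.chart x x)

/-- Surjective smooth maps whose tangent maps are surjective with split kernels. -/
structure IsSubmersion (f : M → N) : Prop where
  surjective : Function.Surjective f
  smooth : Smooth f
  tanMap_surjective : ∀ x, Function.Surjective (tanMap f (rfl : f x = f x))
  ker_split : ∀ x, (LinearMap.ker (tanMap f (rfl : f x = f x)).toLinearMap).ClosedComplemented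

/-- The differential at `x` of a real-valued function. -/
def differential (f : M → ℝ) (x : M) : M.TangentSp x →L[ℝ] ℝ :=
  fderiv ℝ (f ∘ (M.chart x).symm) (M.chart x x)

variable (M)

/-- The derivative at `p` of the change of coordinates from the chart `chart p` to the chart
`chart x`; that is, the trivialization over `(chart x).source` of the tangent bundle. -/
def coordChange (x p : M) : M.TangentSp p →L[ℝ] M.TangentSp x :=
  fderiv ℝ (M.chart x ∘ (M.chart p).symm) (M.chart p p)

end NNHBanachManifold

/-! ## Banach vector bundles -/

/-- Extension by zero of a dependent function on a subset. -/
def extendByZero {X : Type u} {A : X → Type w} [∀ x, Zero (A x)] (U : Set X)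
    (σ : ∀ x : U, A x) (x : X) : A x :=
  open Classical in if h : x ∈ U then σ ⟨x, h⟩ else 0

/-- A Banach vector bundle over `M` with the Banach spaces `A x` as fibres, given by local
trivializations: over the open neighbourhood `baseSet x₀` of `x₀`, the bundle is identified with the
trivial bundle with typical fibre `A x₀` by fibrewise isomorphisms, and the transition functions are
smooth for the operator norm. -/
structure BanachBundle (M : NNHBanachManifold.{u, v}) (A : M → Type w)
    [∀ x, NormedAddCommGroup (A x)] [∀ x, NormedSpace ℝ (A x)] [∀ x, CompleteSpace (A x)] where
  baseSet : M → Set M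
  isOpen_baseSet : ∀ x₀, IsOpen (baseSet x₀)
  mem_baseSet : ∀ x₀, x₀ ∈ baseSet x₀
  triv : ∀ x₀ x, A x →L[ℝ] A x₀
  isInvertible_triv : ∀ x₀, ∀ x ∈ baseSet x₀, (triv x₀ x).IsInvertible
  smooth_transition : ∀ x₀ x₁, ∀ x ∈ baseSet x₀ ∩ baseSet x₁,
    NNHBanachManifold.SmoothFunAt (fun p => (triv x₁ p).comp (triv x₀ p).inverse) x

namespace NNHBanachManifold

variable (M : NNHBanachManifold.{u, v})

theorem contDiffAt_transition {x y p : M} (hx : p ∈ (M.chart x).source)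
    (hy : p ∈ (M.chart y).source) :
    ContDiffAt ℝ ∞ (M.chart y ∘ (M.chart x).symm) (M.chart x p) := by
  refine (M.smooth_transition x y).contDiffAt ?_
  refine ((M.chart x).symm.trans (M.chart y)).open_source.mem_nhds ?_
  simp [hx, hy]

theorem fderiv_transition_comp {x y z p : M} (hx : p ∈ (M.chart x).source)
    (hy : p ∈ (M.chart y).source) (hz : p ∈ (M.chart z).source) :
    (fderiv ℝ (M.chart z ∘ (M.chart y).symm) (M.chart y p)).comp
      (fderiv ℝ (M.chart y ∘ (M.chart x).symm) (M.chart x p)) =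
      fderiv ℝ (M.chart z ∘ (M.chart x).symm) (M.chart x p) := by
  have hinv : (M.chart x).symm (M.chart x p) = p := (M.chart x).left_inv hx
  have h1 := (M.contDiffAt_transition hx hy).differentiableAt (by simp)
  have h2 : DifferentiableAt ℝ (M.chart z ∘ (M.chart y).symm)
      ((M.chart y ∘ (M.chart x).symm) (M.chart x p)) := by
    simp only [Function.comp_apply, hinv]
    exact (M.contDiffAt_transition hy hz).differentiableAt (by simp)
  have h3 := fderiv_comp (M.chart x p) h2 h1
  simp only [Function.comp_apply, hinv] at h3
  rw [← h3]
  apply Filter.EventuallyEq.fderiv_eq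
  have : (M.chart x).symm ⁻¹' (M.chart y).source ∈ 𝓝 (M.chart x p) :=
    ((M.chart x).continuousAt_symm ((M.chart x).map_source hx)).preimage_mem_nhds
      (by rw [hinv]; exact (M.chart y).open_source.mem_nhds hy)
  filter_upwards [this] with a ha
  simp only [Function.comp_apply]
  rw [(M.chart y).left_inv ha]

theorem fderiv_transition_self {x p : M} (hx : p ∈ (M.chart x).source) :
    fderiv ℝ (M.chart x ∘ (M.chart x).symm) (M.chart x p) = ContinuousLinearMap.id ℝ _ := by
  rw [← fderiv_id (𝕜 := ℝ) (x := M.chart x p)]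
  apply Filter.EventuallyEq.fderiv_eq
  filter_upwards [(M.chart x).open_target.mem_nhds ((M.chart x).map_source hx)] with a ha
  simp [(M.chart x).right_inv ha]

/-- The change of coordinates as an isomorphism of the tangent space at `p` onto the model at `x`. -/
def coordChangeEquiv {x p : M} (hp : p ∈ (M.chart x).source) :
    M.TangentSp p ≃L[ℝ] M.TangentSp x :=
  ContinuousLinearEquiv.equivOfInverse (M.coordChange x p)
    (fderiv ℝ (M.chart p ∘ (M.chart x).symm) (M.chart x p))
    (fun a => by
      have h := M.fderiv_transition_comp (M.mem_chart_source p) hp (M.mem_chart_source p)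
      rw [M.fderiv_transition_self (M.mem_chart_source p)] at h
      exact congrArg (fun L => L a) h)
    (fun a => by
      have h := M.fderiv_transition_comp hp (M.mem_chart_source p) hp
      rw [M.fderiv_transition_self hp] at h
      exact congrArg (fun L => L a) h)

theorem coordChange_inverse {x p : M} (hp : p ∈ (M.chart x).source) :
    (M.coordChange x p).inverse = fderiv ℝ (M.chart p ∘ (M.chart x).symm) (M.chart x p) :=
  ContinuousLinearMap.inverse_equiv (M.coordChangeEquiv hp)

/-- The tangent bundle `TM`. -/
def tangentBundle : BanachBundle M M.TangentSp where
  baseSet x := (M.chart x).source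
  isOpen_baseSet x := (M.chart x).open_source
  mem_baseSet := M.mem_chart_source
  triv := M.coordChange
  isInvertible_triv x p hp := ⟨M.coordChangeEquiv hp, rfl⟩
  smooth_transition x y p hp := by
    have hinv : (M.chart p).symm (M.chart p p) = p := (M.chart p).left_inv (M.mem_chart_source p)
    have h1 : ContDiffAt ℝ ∞ (fderiv ℝ (M.chart y ∘ (M.chart x).symm))
        ((M.chart x ∘ (M.chart p).symm) (M.chart p p)) := by
      simp only [Function.comp_apply, hinv]
      exact (M.contDiffAt_transition hp.1 hp.2).fderiv_right (by simp)
    refine (h1.comp _ (M.contDiffAt_transition (M.mem_chart_source p) hp.1)).congr_of_eventuallyEq ?_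
    have hc := (M.chart p).continuousAt_symm ((M.chart p).map_source (M.mem_chart_source p))
    have hx := hc.preimage_mem_nhds
      (by rw [hinv]; exact (M.chart x).open_source.mem_nhds hp.1)
    have hy := hc.preimage_mem_nhds
      (by rw [hinv]; exact (M.chart y).open_source.mem_nhds hp.2)
    filter_upwards [hx, hy] with a hax hay
    simp only [Function.comp_apply]
    rw [M.coordChange_inverse hax]
    exact M.fderiv_transition_comp hax (M.mem_chart_source _) hay

variable {M}

/-- The Lie bracket at `p` of two vector fields on `M` that are smooth near `p`, computed in the
chart `chart p`. -/
def lieBracketAt (X Y : ∀ p : M, M.TangentSp p) (p : M) : M.TangentSp p :=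
  VectorField.lieBracket ℝ
    (fun y => M.coordChange p ((M.chart p).symm y) (X ((M.chart p).symm y)))
    (fun y => M.coordChange p ((M.chart p).symm y) (Y ((M.chart p).symm y)))
    (M.chart p p)

/-- The Lie bracket of two vector fields on the open set `U`. -/
def lieBracket {U : Opens M} (X Y : ∀ p : U, M.TangentSp (p : M)) (p : U) : M.TangentSp (p : M) :=
  lieBracketAt (extendByZero (A := M.TangentSp) (U : Set M) X)
    (extendByZero (A := M.TangentSp) (U : Set M) Y) p

/-- Smooth functions `U → ℝ` on the open set `U`. -/
def IsSmoothFun {U : Opens M} (f : U → ℝ) : Prop :=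
  ∀ x : U, SmoothFunAt (extendByZero (A := fun _ => ℝ) (U : Set M) f) (x : M)

end NNHBanachManifold

open NNHBanachManifold

namespace BanachBundle

variable {M : NNHBanachManifold.{u, v}} {A : M → Type w}
  [∀ x, NormedAddCommGroup (A x)] [∀ x, NormedSpace ℝ (A x)] [∀ x, CompleteSpace (A x)]
  {N : NNHBanachManifold.{u', v'}} {B : N → Type w'}
  [∀ x, NormedAddCommGroup (B x)] [∀ x, NormedSpace ℝ (B x)] [∀ x, CompleteSpace (B x)]

/-- Smoothness of a section at the point `x`. -/
def SmoothSectionAt (𝒜 : BanachBundle M A) (σ : ∀ x, A x) (x : M) : Prop :=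
  ∀ x₀, x ∈ 𝒜.baseSet x₀ → SmoothFunAt (fun p => 𝒜.triv x₀ p (σ p)) x

/-- The space of smooth sections over the open set `U`. -/
def sections (𝒜 : BanachBundle M A) (U : Opens M) : Submodule ℝ (∀ x : U, A x) where
  carrier := {σ | ∀ x : U, 𝒜.SmoothSectionAt (extendByZero (U : Set M) σ) (x : M)}
  zero_mem' := by
    intro x x₀ _
    have : (fun p => 𝒜.triv x₀ p (extendByZero (U : Set M) (0 : ∀ x : U, A x) p)) =
        fun _ => 0 := by
      funext p
      by_cases h : p ∈ (U : Set M) <;> simp [extendByZero, h]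
    rw [this]
    exact contDiffAt_const
  add_mem' := by
    intro σ τ hσ hτ x x₀ hx
    have : (fun p => 𝒜.triv x₀ p (extendByZero (U : Set M) (σ + τ) p)) =
        fun p => 𝒜.triv x₀ p (extendByZero (U : Set M) σ p) +
          𝒜.triv x₀ p (extendByZero (U : Set M) τ p) := by
      funext p
      rw [← map_add]
      by_cases h : p ∈ (U : Set M) <;> simp [extendByZero, h]
    rw [this]
    exact ContDiffAt.add (hσ x x₀ hx) (hτ x x₀ hx)
  smul_mem' := by
    intro c σ hσ x x₀ hx
    have : (fun p => 𝒜.triv x₀ p (extendByZero (U : Set M) (c • σ) p)) =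
        fun p => c • 𝒜.triv x₀ p (extendByZero (U : Set M) σ p) := by
      funext p
      rw [← map_smul]
      by_cases h : p ∈ (U : Set M) <;> simp [extendByZero, h]
    rw [this]
    exact ContDiffAt.const_smul c (hσ x x₀ hx)

/-- The restriction of a section to a smaller open set. -/
def restrict (𝒜 : BanachBundle M A) {V U : Opens M} (hVU : V ≤ U) (σ : 𝒜.sections U) :
    𝒜.sections V :=
  ⟨fun x => σ.1 ⟨x, hVU x.2⟩, by
    intro x x₀ hx
    refine (σ.2 ⟨x, hVU x.2⟩ x₀ hx).congr_of_eventuallyEq ?_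
    have hinv : (M.chart x).symm (M.chart x x) = x := (M.chart x).left_inv (M.mem_chart_source x)
    have hc := (M.chart (x : M)).continuousAt_symm
      ((M.chart (x : M)).map_source (M.mem_chart_source x))
    have hV := hc.preimage_mem_nhds (t := (V : Set M))
      (by rw [hinv]; exact V.isOpen.mem_nhds x.2)
    filter_upwards [hV] with a ha
    have ha' : (M.chart (x : M)).symm a ∈ (V : Set M) := ha
    have hU' : (M.chart (x : M)).symm a ∈ (U : Set M) := hVU ha'
    simp only [Function.comp_apply, extendByZero, dif_pos ha', dif_pos hU']⟩

/-- The product of a smooth function and a section, over the open set `U`. -/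
def funSMul (𝒜 : BanachBundle M A) {U : Opens M} (f : U → ℝ) (hf : IsSmoothFun f)
    (σ : 𝒜.sections U) : 𝒜.sections U :=
  ⟨fun x => f x • σ.1 x, by
    intro x x₀ hx
    have : (fun p => 𝒜.triv x₀ p (extendByZero (U : Set M) (fun x : U => f x • σ.1 x) p)) =
        fun p => extendByZero (A := fun _ => ℝ) (U : Set M) f p •
          𝒜.triv x₀ p (extendByZero (U : Set M) σ.1 p) := by
      funext p
      rw [← map_smul]
      by_cases h : p ∈ (U : Set M) <;> simp [extendByZero, h]
    rw [this]
    exact ContDiffAt.smul (hf x) (σ.2 x x₀ hx)⟩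

/-- A family of continuous linear maps `A x → B (φ x)` is a (smooth) morphism of Banach bundles
covering the smooth map `φ`. -/
def IsMorphism (𝒜 : BanachBundle M A) (ℬ : BanachBundle N B) (φ : M → N)
    (T : ∀ x, A x →L[ℝ] B (φ x)) : Prop :=
  Smooth φ ∧ ∀ x₀ y₀ x, x ∈ 𝒜.baseSet x₀ → φ x ∈ ℬ.baseSet y₀ →
    SmoothFunAt (fun p => ((ℬ.triv y₀ (φ p)).comp (T p)).comp (𝒜.triv x₀ p).inverse) x

/-! ## Banach-Lie algebroids -/

/-- Over the open set `U`, a Lie bracket on the anchored bundle `(𝒜, ρ)`. -/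
structure IsLieBracket (𝒜 : BanachBundle M A) (ρ : ∀ x, A x →L[ℝ] M.TangentSp x) (U : Opens M)
    (br : 𝒜.sections U →ₗ[ℝ] 𝒜.sections U →ₗ[ℝ] 𝒜.sections U) : Prop where
  skew : ∀ σ τ, br σ τ = -br τ σ
  leibniz : ∀ (f : U → ℝ) (hf : IsSmoothFun f) (σ τ : 𝒜.sections U) (x : U),
    (br σ (𝒜.funSMul f hf τ)).1 x = f x • (br σ τ).1 x +
      differential (extendByZero (A := fun _ => ℝ) (U : Set M) f) (x : M) (ρ x (σ.1 x)) • τ.1 x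
  jacobi : ∀ σ₁ σ₂ σ₃, br σ₁ (br σ₂ σ₃) + br σ₂ (br σ₃ σ₁) + br σ₃ (br σ₁ σ₂) = 0

/-- The brackets `brs U` on the restrictions of `(𝒜, ρ)` to the open sets `U ⊆ M` localize the
bracket `br`. -/
structure IsLocalizedBy (𝒜 : BanachBundle M A) (ρ : ∀ x, A x →L[ℝ] M.TangentSp x)
    (br : 𝒜.sections ⊤ →ₗ[ℝ] 𝒜.sections ⊤ →ₗ[ℝ] 𝒜.sections ⊤)
    (brs : ∀ U : Opens M, 𝒜.sections U →ₗ[ℝ] 𝒜.sections U →ₗ[ℝ] 𝒜.sections U) : Prop where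
  isLieBracket : ∀ U, 𝒜.IsLieBracket ρ U (brs U)
  top : brs ⊤ = br
  restrict : ∀ (V U : Opens M) (hVU : V ≤ U) (σ τ : 𝒜.sections U),
    brs V (𝒜.restrict hVU σ) (𝒜.restrict hVU τ) = 𝒜.restrict hVU (brs U σ τ)

/-- Over the open set `U`, the anchor carries the bracket of sections to the bracket of vector
fields. -/
def IsLieMorphism (𝒜 : BanachBundle M A) (ρ : ∀ x, A x →L[ℝ] M.TangentSp x) (U : Opens M)
    (br : 𝒜.sections U →ₗ[ℝ] 𝒜.sections U →ₗ[ℝ] 𝒜.sections U) : Prop :=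
  ∀ (σ τ : 𝒜.sections U) (x : U), ρ x ((br σ τ).1 x) =
    NNHBanachManifold.lieBracket (fun y : U => ρ y (σ.1 y)) (fun y : U => ρ y (τ.1 y)) x

/-- `(𝒜, M, ρ, br)` is a Banach-Lie algebroid: `ρ` is an anchor, `br` is a localizable Lie bracket
on the anchored bundle, and the anchor is a Lie algebra morphism. -/
structure IsBanachLieAlgebroid (𝒜 : BanachBundle M A) (ρ : ∀ x, A x →L[ℝ] M.TangentSp x)
    (br : 𝒜.sections ⊤ →ₗ[ℝ] 𝒜.sections ⊤ →ₗ[ℝ] 𝒜.sections ⊤) : Prop where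
  isAnchor : 𝒜.IsMorphism M.tangentBundle id ρ
  isLieBracket : 𝒜.IsLieBracket ρ ⊤ br
  isLocalizable : ∃ brs, 𝒜.IsLocalizedBy ρ br brs
  isLieMorphism : 𝒜.IsLieMorphism ρ ⊤ br

end BanachBundle

/-! ## Groupoids -/

/-- A topological groupoid, with Hausdorff base `M`.  The product `mul g h` is only meaningful when
`src g = tgt h`; nothing is assumed about the other values. -/
structure TopGroupoid (G : Type u) (M : Type u') [TopologicalSpace G] [TopologicalSpace M] where
  t2Space_base : T2Space M
  src : G → M
  tgt : G → M
  mul : G → G → G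
  one : M → G
  inv : G ≃ₜ G
  src_surjective : Function.Surjective src
  src_continuous : Continuous src
  src_isOpenMap : IsOpenMap src
  tgt_surjective : Function.Surjective tgt
  tgt_continuous : Continuous tgt
  tgt_isOpenMap : IsOpenMap tgt
  mul_continuousOn : ContinuousOn (fun p : G × G => mul p.1 p.2) {p | src p.1 = tgt p.2}
  src_mul : ∀ g h, src g = tgt h → src (mul g h) = src h
  tgt_mul : ∀ g h, src g = tgt h → tgt (mul g h) = tgt g
  mul_assoc : ∀ g h k, src g = tgt h → src h = tgt k → mul (mul g h) k = mul g (mul h k)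
  one_isEmbedding : IsEmbedding one
  src_one : ∀ x, src (one x) = x
  tgt_one : ∀ x, tgt (one x) = x
  mul_one : ∀ g, mul g (one (src g)) = g
  one_mul : ∀ g, mul (one (tgt g)) g = g
  src_inv : ∀ g, src (inv g) = tgt g
  tgt_inv : ∀ g, tgt (inv g) = src g
  mul_inv : ∀ g, mul g (inv g) = one (tgt g)
  inv_mul : ∀ g, mul (inv g) g = one (src g)

/-- A not necessarily Hausdorff Banach-Lie groupoid `G ⇉ M`.  Smoothness of the multiplication on the
split submanifold `{(g, h) | src g = tgt h}` of `G × G` is expressed, as usual, by the existence of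
smooth local extensions to open subsets of `G × G`. -/
structure NNHBanachLieGroupoid where
  G : NNHBanachManifold.{u, v}
  M : NNHBanachManifold.{u', v'}
  toTop : TopGroupoid G M
  src_isSubmersion : IsSubmersion (M := G) (N := M) toTop.src
  inv_smooth : Smooth (M := G) (N := G) toTop.inv
  mul_smooth : ∀ g h : G, toTop.src g = toTop.tgt h →
    ∃ (W : Set (G.Model g × G.Model h)) (F : G.Model g × G.Model h → G.Model (toTop.mul g h)),
      IsOpen W ∧ (G.chart g g, G.chart h h) ∈ W ∧ ContDiffOn ℝ ∞ F W ∧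
      ∀ a ∈ (G.chart g).source, ∀ b ∈ (G.chart h).source,
        (G.chart g a, G.chart h b) ∈ W → toTop.src a = toTop.tgt b →
          toTop.mul a b ∈ (G.chart (toTop.mul g h)).source ∧
          G.chart (toTop.mul g h) (toTop.mul a b) = F (G.chart g a, G.chart h b)

namespace NNHBanachLieGroupoid

variable (𝓖 : NNHBanachLieGroupoid.{u, v, u', v'})

/-- The source map. -/
abbrev src : 𝓖.G → 𝓖.M := 𝓖.toTop.src

/-- The target map. -/
abbrev tgt : 𝓖.G → 𝓖.M := 𝓖.toTop.tgt

/-- The multiplication. -/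
abbrev mul : 𝓖.G → 𝓖.G → 𝓖.G := 𝓖.toTop.mul

/-- The identity section. -/
abbrev one : 𝓖.M → 𝓖.G := 𝓖.toTop.one

/-- The kernel of `T_g s`, which is the fibre at `g` of the subbundle `ker Ts` of `TG`. -/
abbrev kerTsrc (g : 𝓖.G) : Submodule ℝ (𝓖.G.TangentSp g) :=
  LinearMap.ker (tanMap (M := 𝓖.G) (N := 𝓖.M) 𝓖.src (rfl : 𝓖.src g = 𝓖.src g)).toLinearMap

/-- The fibre at `x` of the pullback by the identity section of the bundle `ker Ts`. -/
abbrev AFiber (x : 𝓖.M) : Type v := 𝓖.kerTsrc (𝓖.one x)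

instance (x : 𝓖.M) : CompleteSpace (𝓖.AFiber x) :=
  ContinuousLinearMap.completeSpace_ker
    (tanMap (M := 𝓖.G) (N := 𝓖.M) 𝓖.src (rfl : 𝓖.src (𝓖.one x) = 𝓖.src (𝓖.one x)))

/-- A bundle structure on the family of the fibres `ker T_{1_x} s` is the one of the pullback of
`ker Ts ⊆ TG` by the identity section: the fibrewise inclusions form a smooth bundle morphism into
`TG` covering the identity section.  Since these inclusions have split ranges, this determines the
bundle structure. -/
def IsPullbackBundle (𝒜 : BanachBundle 𝓖.M 𝓖.AFiber) : Prop :=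
  𝒜.IsMorphism 𝓖.G.tangentBundle 𝓖.one (fun x => (𝓖.kerTsrc (𝓖.one x)).subtypeL)

/-- The anchor, that is, `v ↦ Tt v` on `ker T_{1_x} s`. -/
def anchor (x : 𝓖.M) : 𝓖.AFiber x →L[ℝ] 𝓖.M.TangentSp x :=
  (tanMap (M := 𝓖.G) (N := 𝓖.M) 𝓖.tgt (𝓖.toTop.tgt_one x)).comp
    (𝓖.kerTsrc (𝓖.one x)).subtypeL

/-- The open set `t⁻¹(U)` of arrows. -/
def arrowsInto (U : Opens 𝓖.M) : Opens 𝓖.G := ⟨𝓖.tgt ⁻¹' U, U.isOpen.preimage 𝓖.toTop.tgt_continuous⟩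

/-- The identity arrow at a point of `U`, as an element of `t⁻¹(U)`. -/
def oneInto {U : Opens 𝓖.M} (x : U) : 𝓖.arrowsInto U :=
  ⟨𝓖.one x, by
    have h := x.2
    rw [← 𝓖.toTop.tgt_one x] at h
    exact h⟩

/-- The product `h g`, as an element of `t⁻¹(U)` when `h` is one. -/
def mulInto {U : Opens 𝓖.M} (h : 𝓖.arrowsInto U) (g : 𝓖.G) (hg : 𝓖.src h = 𝓖.tgt g) :
    𝓖.arrowsInto U :=
  ⟨𝓖.mul h g, (congrArg (fun y => y ∈ U) (𝓖.toTop.tgt_mul h g hg)).mpr h.2⟩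

/-- The tangent map at `h` of the right translation `R_g : s⁻¹(t(g)) → s⁻¹(s(g))`, `k ↦ k g`; it is
meaningful on `ker T_h s`, which is the tangent space at `h` of the submanifold `s⁻¹(t(g))`. -/
def tangentRightMul (h g : 𝓖.G) : 𝓖.G.TangentSp h →L[ℝ] 𝓖.G.TangentSp (𝓖.mul h g) :=
  tanMapWithin (M := 𝓖.G) (N := 𝓖.G) (fun k => 𝓖.mul k g) {k | 𝓖.src k = 𝓖.tgt g} h

/-- The right-invariant vector fields on `t⁻¹(U)`: the smooth vector fields tangent to the fibres
of `s` and invariant under all right translations. -/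
def rightInvariant (U : Opens 𝓖.M) :
    Submodule ℝ (𝓖.G.tangentBundle.sections (𝓖.arrowsInto U)) where
  carrier := {X | (∀ h : 𝓖.arrowsInto U, X.1 h ∈ 𝓖.kerTsrc (h : 𝓖.G)) ∧
    ∀ (h : 𝓖.arrowsInto U) (g : 𝓖.G) (hg : 𝓖.src h = 𝓖.tgt g),
      X.1 (𝓖.mulInto h g hg) = 𝓖.tangentRightMul h g (X.1 h)}
  zero_mem' := ⟨fun _ => Submodule.zero_mem _, fun _ _ _ => (map_zero _).symm⟩
  add_mem' := fun hX hY => ⟨fun h => Submodule.add_mem _ (hX.1 h) (hY.1 h), fun h g hg =>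
    (congrArg₂ (fun a b => a + b) (hX.2 h g hg) (hY.2 h g hg)).trans (map_add _ _ _).symm⟩
  smul_mem' := fun c _ hX => ⟨fun h => Submodule.smul_mem _ c (hX.1 h), fun h g hg =>
    (congrArg (fun a => c • a) (hX.2 h g hg)).trans (map_smul _ _ _).symm⟩

/-- Given, over every open `U ⊆ M`, an identification `Φ U` of the sections of `𝒜` over `U` with the
right-invariant vector fields on `t⁻¹(U)`: the brackets `br U` are those for which `Φ U` carries the
bracket of sections to the Lie bracket of vector fields. -/
def IsRightInvariantBracket (𝒜 : BanachBundle 𝓖.M 𝓖.AFiber)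
    (Φ : ∀ U : Opens 𝓖.M, 𝒜.sections U ≃ₗ[ℝ] 𝓖.rightInvariant U)
    (br : ∀ U : Opens 𝓖.M, 𝒜.sections U →ₗ[ℝ] 𝒜.sections U →ₗ[ℝ] 𝒜.sections U) : Prop :=
  ∀ (U : Opens 𝓖.M) (X Y : 𝒜.sections U) (g : 𝓖.arrowsInto U),
    (Φ U (br U X Y)).1.1 g = NNHBanachManifold.lieBracket (Φ U X).1.1 (Φ U Y).1.1 g

end NNHBanachLieGroupoid

end

/-!
Vectors tangent to a fibre of a submersion are velocities of curves in that fibre, and a tangent map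
acts on the velocity of a curve by composition with the curve.  With this description
(`HasVelocity`), the algebraic properties of right translations follow from the groupoid axioms,
applied to curves in the fibres of the source map: if `c` is such a curve through `1_{t(g)}` with
velocity `X_{t(g)}`, the right-invariant extension of a section `X` has at `g` the velocity of
`τ ↦ c(τ) g` (`hasVelocity_rightExt`).  So the extension is tangent to the source fibres,
right-invariant, equal to `X` along the identity section, and `t`-related to the anchor applied to
`X`.  It is smooth because in charts it is the partial derivative of the multiplication along
`X ∘ t` (`smoothSectionAt_rightExt`).

The identity section is smooth since it is `g⁻¹ g` along local sections of the source map
(`smoothAt_one`).  Near `x₀`, the pairing of a fixed projection onto `ker T_{1_{x₀}} s` with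
`T_{1_x} s` remains an isomorphism, which trivializes the kernels `ker T_{1_x} s` (`splitting`).

All statements on brackets rest on the fact that Lie brackets of related vector fields are related
(`tanMap_lieBracketAt`).  Applied to transition maps, it makes the bracket independent of charts;
applied to `s` it shows that brackets of right-invariant fields are tangent to the source fibres;
applied to `t` it shows that the anchor preserves brackets.  A right translation is only defined on
one source fibre, so it is extended to `k ↦ k γ(s(k))` with a local section `γ` of `t`; this map
preserves right-invariant fields, hence their brackets (`lieBracketAt_mul`).  The Jacobi and Leibniz
rules and compatibility with restrictions are then inherited from vector fields on `G`.
-/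

noncomputable section

/-! ### Smooth maps at a point -/

namespace NNHBanachManifold

open Filter

variable {M : NNHBanachManifold.{u, v}} {N : NNHBanachManifold.{u', v'}}
  {F : Type*} [NormedAddCommGroup F] [NormedSpace ℝ F]

theorem tendsto_chart_symm {x y : M} (hx : x ∈ (M.chart y).source) :
    Tendsto (M.chart y).symm (𝓝 (M.chart y x)) (𝓝 x) := by
  have h := (M.chart y).continuousAt_symm ((M.chart y).map_source hx)
  rwa [ContinuousAt, (M.chart y).left_inv hx] at h

theorem smoothFunAt_iff {f : M → F} {x y : M} (hx : x ∈ (M.chart y).source) :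
    SmoothFunAt f x ↔ ContDiffAt ℝ ∞ (f ∘ (M.chart y).symm) (M.chart y x) := by
  have key : ∀ {a b : M}, x ∈ (M.chart a).source → x ∈ (M.chart b).source →
      ContDiffAt ℝ ∞ (f ∘ (M.chart a).symm) (M.chart a x) →
      ContDiffAt ℝ ∞ (f ∘ (M.chart b).symm) (M.chart b x) := by
    intro a b ha hb h
    have h' : ContDiffAt ℝ ∞ (f ∘ (M.chart a).symm)
        ((M.chart a ∘ (M.chart b).symm) (M.chart b x)) := by
      simpa only [Function.comp_apply, (M.chart b).left_inv hb] using h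
    refine (h'.comp _ (M.contDiffAt_transition hb ha)).congr_of_eventuallyEq ?_
    filter_upwards [tendsto_chart_symm hb ((M.chart a).open_source.mem_nhds ha)] with z hz
    simp only [Function.comp_apply, (M.chart a).left_inv hz]
  exact ⟨key (M.mem_chart_source x) hx, key hx (M.mem_chart_source x)⟩

theorem SmoothFunAt.congr_of_eventuallyEq {f f' : M → F} {x : M} (h : SmoothFunAt f x)
    (hf : f' =ᶠ[𝓝 x] f) : SmoothFunAt f' x :=
  ContDiffAt.congr_of_eventuallyEq h (tendsto_chart_symm (M.mem_chart_source x) hf)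

theorem SmoothFunAt.continuousAt {f : M → F} {x : M} (h : SmoothFunAt f x) :
    ContinuousAt f x := by
  have h1 : ContinuousAt (f ∘ (M.chart x).symm) (M.chart x x) := ContDiffAt.continuousAt h
  have h2 := ContinuousAt.comp h1 ((M.chart x).continuousAt (M.mem_chart_source x))
  refine h2.congr ?_
  filter_upwards [(M.chart x).open_source.mem_nhds (M.mem_chart_source x)] with z hz
  simp only [Function.comp_apply, (M.chart x).left_inv hz]

theorem smoothFunAt_chart {x y : M} (hx : x ∈ (M.chart y).source) :
    SmoothFunAt (M.chart y) x :=
  M.contDiffAt_transition (M.mem_chart_source x) hx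

theorem SmoothFunAt.comp_contDiffAt {F' : Type*} [NormedAddCommGroup F'] [NormedSpace ℝ F']
    {g : F → F'} {f : M → F} {x : M} (hg : ContDiffAt ℝ ∞ g (f x)) (hf : SmoothFunAt f x) :
    SmoothFunAt (fun y => g (f y)) x := by
  refine ContDiffAt.comp (g := g) (M.chart x x) ?_ hf
  simpa only [Function.comp_apply, (M.chart x).left_inv (M.mem_chart_source x)] using hg

/-- Smoothness at `x` of a map between manifolds. -/
def SmoothAt (f : M → N) (x : M) : Prop :=
  ContinuousAt f x ∧ SmoothFunAt (N.chart (f x) ∘ f) x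

theorem Smooth.smoothAt {f : M → N} (h : Smooth f) (x : M) : SmoothAt f x :=
  ⟨h.1.continuousAt, h.2 x⟩

theorem smooth_of_smoothAt {f : M → N} (h : ∀ x, SmoothAt f x) : Smooth f :=
  ⟨continuous_iff_continuousAt.2 fun x => (h x).1, fun x => (h x).2⟩

theorem SmoothFunAt.comp {φ : N → F} {f : M → N} {x : M} (hφ : SmoothFunAt φ (f x))
    (hf : SmoothAt f x) : SmoothFunAt (φ ∘ f) x := by
  have hx := M.mem_chart_source x
  have h' : ContDiffAt ℝ ∞ (φ ∘ (N.chart (f x)).symm)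
      ((N.chart (f x) ∘ f ∘ (M.chart x).symm) (M.chart x x)) := by
    simp only [Function.comp_apply, (M.chart x).left_inv hx]
    exact hφ
  refine (h'.comp _ hf.2).congr_of_eventuallyEq ?_
  filter_upwards [tendsto_chart_symm hx
    (hf.1.preimage_mem_nhds ((N.chart (f x)).open_source.mem_nhds (N.mem_chart_source _)))]
    with z hz
  have hz' : f ((M.chart x).symm z) ∈ (N.chart (f x)).source := hz
  simp only [Function.comp_apply, (N.chart (f x)).left_inv hz']

theorem SmoothAt.smoothFunAt_chart_comp {f : M → N} {x : M} {y : N} (hf : SmoothAt f x)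
    (hy : f x ∈ (N.chart y).source) : SmoothFunAt (N.chart y ∘ f) x :=
  (smoothFunAt_chart hy).comp hf

theorem SmoothAt.comp {P : NNHBanachManifold.{w, w'}} {g : N → P} {f : M → N} {x : M}
    (hg : SmoothAt g (f x)) (hf : SmoothAt f x) : SmoothAt (g ∘ f) x :=
  ⟨hg.1.comp hf.1, hg.2.comp hf⟩

theorem smoothAt_id (x : M) : SmoothAt (fun y : M => y) x :=
  ⟨continuousAt_id, smoothFunAt_chart (M.mem_chart_source x)⟩

theorem SmoothAt.congr_of_eventuallyEq {f f' : M → N} {x : M} (h : SmoothAt f x)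
    (hf : f' =ᶠ[𝓝 x] f) : SmoothAt f' x := by
  refine ⟨h.1.congr hf.symm, ?_⟩
  rw [hf.eq_of_nhds]
  exact h.2.congr_of_eventuallyEq (hf.fun_comp _)

/-- A map that is continuous and smooth when read in some chart of the target is smooth. -/
theorem smoothAt_of_chart_comp {f : M → N} {x : M} {y : N} (hc : ContinuousAt f x)
    (hy : f x ∈ (N.chart y).source) (h : SmoothFunAt (N.chart y ∘ f) x) : SmoothAt f x := by
  refine ⟨hc, ?_⟩
  have h1 : ContDiffAt ℝ ∞ (N.chart (f x) ∘ (N.chart y).symm) ((N.chart y ∘ f) x) :=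
    N.contDiffAt_transition hy (N.mem_chart_source _)
  refine (SmoothFunAt.comp_contDiffAt h1 h).congr_of_eventuallyEq ?_
  filter_upwards [hc ((N.chart y).open_source.mem_nhds hy)] with z hz
  have hz' : f z ∈ (N.chart y).source := hz
  simp only [Function.comp_apply, (N.chart y).left_inv hz']

/-- The inverse of a chart composed with a smooth function is smooth. -/
theorem smoothAt_chart_symm_comp {y : N} {φ : M → N.Model y} {x : M} (hφ : SmoothFunAt φ x)
    (hx : φ x ∈ (N.chart y).target) : SmoothAt ((N.chart y).symm ∘ φ) x := by
  have hc : ContinuousAt ((N.chart y).symm ∘ φ) x :=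
    ((N.chart y).continuousAt_symm hx).comp hφ.continuousAt
  refine smoothAt_of_chart_comp (y := y) hc ((N.chart y).map_target hx) ?_
  refine hφ.congr_of_eventuallyEq ?_
  filter_upwards [hφ.continuousAt ((N.chart y).open_target.mem_nhds hx)] with z hz
  have hz' : φ z ∈ (N.chart y).target := hz
  simp only [Function.comp_apply, (N.chart y).right_inv hz']

theorem SmoothFunAt.prodMk {F' : Type*} [NormedAddCommGroup F'] [NormedSpace ℝ F']
    {f : M → F} {g : M → F'} {x : M} (hf : SmoothFunAt f x) (hg : SmoothFunAt g x) :
    SmoothFunAt (fun y => (f y, g y)) x :=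
  ContDiffAt.prodMk hf hg

theorem SmoothFunAt.clm_apply {F' : Type*} [NormedAddCommGroup F'] [NormedSpace ℝ F']
    {f : M → F →L[ℝ] F'} {g : M → F} {x : M} (hf : SmoothFunAt f x) (hg : SmoothFunAt g x) :
    SmoothFunAt (fun y => f y (g y)) x :=
  ContDiffAt.clm_apply hf hg

theorem SmoothFunAt.clm_comp {F' F'' : Type*} [NormedAddCommGroup F'] [NormedSpace ℝ F']
    [NormedAddCommGroup F''] [NormedSpace ℝ F'']
    {f : M → F' →L[ℝ] F''} {g : M → F →L[ℝ] F'} {x : M} (hf : SmoothFunAt f x)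
    (hg : SmoothFunAt g x) : SmoothFunAt (fun y => (f y).comp (g y)) x :=
  ContDiffAt.clm_comp hf hg

theorem smoothFunAt_const (a : F) (x : M) : SmoothFunAt (fun _ => a) x :=
  contDiffAt_const

/-! ### Velocities of curves and tangent maps -/

/-- The differentiability at `x` of a map between manifolds.  Unlike smoothness at a point, which is
`C^n` near the point for each `n` separately, it holds near every point of smoothness. -/
def DiffAt (f : M → N) (x : M) : Prop :=
  ContinuousAt f x ∧ DifferentiableAt ℝ (N.chart (f x) ∘ f ∘ (M.chart x).symm) (M.chart x x)

theorem SmoothAt.diffAt {f : M → N} {x : M} (h : SmoothAt f x) : DiffAt f x :=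
  ⟨h.1, ContDiffAt.differentiableAt h.2 (by simp)⟩

/-- The curve `c` passes at time `0` through `p`, with velocity `v`. -/
structure HasVelocity (c : ℝ → M) (p : M) (v : M.TangentSp p) : Prop where
  map_zero : c 0 = p
  continuousAt : ContinuousAt c 0
  hasDerivAt : HasDerivAt (M.chart p ∘ c) v 0

theorem HasVelocity.tendsto {c : ℝ → M} {p : M} {v : M.TangentSp p} (h : HasVelocity c p v) :
    Tendsto c (𝓝 0) (𝓝 p) := by
  have := h.continuousAt
  rwa [ContinuousAt, h.map_zero] at this

theorem HasVelocity.unique {c : ℝ → M} {p : M} {v w : M.TangentSp p} (hv : HasVelocity c p v)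
    (hw : HasVelocity c p w) : v = w :=
  hv.hasDerivAt.unique hw.hasDerivAt

theorem HasVelocity.congr_of_eventuallyEq {c c' : ℝ → M} {p : M} {v : M.TangentSp p}
    (h : HasVelocity c p v) (hc : c' =ᶠ[𝓝 0] c) : HasVelocity c' p v :=
  ⟨hc.eq_of_nhds.trans h.map_zero, h.continuousAt.congr hc.symm,
    h.hasDerivAt.congr_of_eventuallyEq (hc.fun_comp _)⟩

theorem hasVelocity_const (p : M) : HasVelocity (fun _ => p) p 0 :=
  ⟨rfl, continuousAt_const, hasDerivAt_const _ _⟩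

/-- A curve which is differentiable when read in `chart p` has a velocity. -/
theorem hasVelocity_chart_symm {p : M} {γ : ℝ → M.Model p} {v : M.TangentSp p}
    (h0 : γ 0 = M.chart p p) (h : HasDerivAt γ v 0) :
    HasVelocity ((M.chart p).symm ∘ γ) p v := by
  have hp := M.mem_chart_source p
  have ht : γ 0 ∈ (M.chart p).target := h0 ▸ (M.chart p).map_source hp
  refine ⟨?_, ((M.chart p).continuousAt_symm ht).comp h.continuousAt, ?_⟩
  · simp only [Function.comp_apply, h0, (M.chart p).left_inv hp]
  · refine h.congr_of_eventuallyEq ?_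
    filter_upwards [h.continuousAt ((M.chart p).open_target.mem_nhds ht)] with z hz
    have hz' : γ z ∈ (M.chart p).target := hz
    simp only [Function.comp_apply, (M.chart p).right_inv hz']

theorem exists_hasVelocity (p : M) (v : M.TangentSp p) : ∃ c, HasVelocity c p v := by
  refine ⟨_, hasVelocity_chart_symm (γ := fun τ => M.chart p p + τ • v) (by simp) ?_⟩
  simpa using ((hasDerivAt_id (0 : ℝ)).smul_const v).const_add (M.chart p p)

theorem HasVelocity.hasDerivAt_of_hasFDerivAt {c : ℝ → M} {p : M} {v : M.TangentSp p}
    (h : HasVelocity c p v) {f : M → F} {f' : M.TangentSp p →L[ℝ] F}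
    (hf : HasFDerivAt (f ∘ (M.chart p).symm) f' (M.chart p p)) :
    HasDerivAt (f ∘ c) (f' v) 0 := by
  have h1 := hf.comp_hasDerivAt_of_eq (0 : ℝ) h.hasDerivAt
    (by simp only [Function.comp_apply, h.map_zero])
  refine h1.congr_of_eventuallyEq ?_
  filter_upwards [h.tendsto ((M.chart p).open_source.mem_nhds (M.mem_chart_source p))] with τ hτ
  have hτ' : c τ ∈ (M.chart p).source := hτ
  simp only [Function.comp_apply, (M.chart p).left_inv hτ']

theorem HasVelocity.hasDerivAt_chart {c : ℝ → M} {p x : M} {v : M.TangentSp p}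
    (h : HasVelocity c p v) (hp : p ∈ (M.chart x).source) :
    HasDerivAt (M.chart x ∘ c) (M.coordChange x p v) 0 :=
  h.hasDerivAt_of_hasFDerivAt
    ((M.contDiffAt_transition (M.mem_chart_source p) hp).differentiableAt
      (by simp)).hasFDerivAt

theorem HasVelocity.map {c : ℝ → M} {p : M} {v : M.TangentSp p} (h : HasVelocity c p v)
    {f : M → N} {q : N} (hf : DiffAt f p) (hq : f p = q) :
    HasVelocity (f ∘ c) q (tanMap f hq v) := by
  subst hq
  refine ⟨by simp only [Function.comp_apply, h.map_zero],
    ContinuousAt.comp_of_eq hf.1 h.continuousAt h.map_zero, ?_⟩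
  exact h.hasDerivAt_of_hasFDerivAt (f := N.chart (f p) ∘ f) hf.2.hasFDerivAt

theorem coordChange_injective {x p : M} (hp : p ∈ (M.chart x).source) :
    Function.Injective (M.coordChange x p) :=
  (M.coordChangeEquiv hp).injective

theorem differentiableAt_chart_read {f : M → F} {x y z : M} (hy : x ∈ (M.chart y).source)
    (hz : x ∈ (M.chart z).source)
    (h : DifferentiableAt ℝ (f ∘ (M.chart y).symm) (M.chart y x)) :
    DifferentiableAt ℝ (f ∘ (M.chart z).symm) (M.chart z x) := by
  have h' : DifferentiableAt ℝ (f ∘ (M.chart y).symm)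
      ((M.chart y ∘ (M.chart z).symm) (M.chart z x)) := by
    simpa only [Function.comp_apply, (M.chart z).left_inv hz] using h
  refine (h'.comp _ ((M.contDiffAt_transition hz hy).differentiableAt
    (by simp))).congr_of_eventuallyEq ?_
  filter_upwards [tendsto_chart_symm hz ((M.chart y).open_source.mem_nhds hy)] with a ha
  simp only [Function.comp_apply, (M.chart y).left_inv ha]

theorem SmoothFunAt.eventually_differentiableAt {f : M → F} {x : M} (h : SmoothFunAt f x) :
    ∀ᶠ y in 𝓝 x, DifferentiableAt ℝ (f ∘ (M.chart y).symm) (M.chart y y) := by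
  have hx := M.mem_chart_source x
  have h1 : ∀ᶠ z in 𝓝 (M.chart x x), DifferentiableAt ℝ (f ∘ (M.chart x).symm) z :=
    ((ContDiffAt.of_le h (m := 1) (by exact_mod_cast le_top)).eventually (by simp)).mono
      fun z hz => hz.differentiableAt (by simp)
  filter_upwards [((M.chart x).continuousAt hx).eventually h1,
    (M.chart x).open_source.mem_nhds hx] with y hy hyx
  exact differentiableAt_chart_read hyx (M.mem_chart_source y) hy

theorem continuousAt_of_differentiableAt_chart {f : M → F} {x : M}
    (h : DifferentiableAt ℝ (f ∘ (M.chart x).symm) (M.chart x x)) : ContinuousAt f x := by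
  refine (ContinuousAt.comp h.continuousAt
    ((M.chart x).continuousAt (M.mem_chart_source x))).congr ?_
  filter_upwards [(M.chart x).open_source.mem_nhds (M.mem_chart_source x)] with z hz
  simp only [Function.comp_apply, (M.chart x).left_inv hz]

theorem SmoothAt.eventually_diffAt {f : M → N} {x : M} (h : SmoothAt f x) :
    ∀ᶠ y in 𝓝 x, DiffAt f y := by
  have hs : ∀ᶠ y in 𝓝 x, f y ∈ (N.chart (f x)).source :=
    h.1 ((N.chart (f x)).open_source.mem_nhds (N.mem_chart_source _))
  filter_upwards [h.2.eventually_differentiableAt, hs.eventually_nhds] with y hy hys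
  have hyx : f y ∈ (N.chart (f x)).source := hys.self_of_nhds
  have hc : ContinuousAt f y := by
    have h1 : ContinuousAt ((N.chart (f x)).symm ∘ N.chart (f x) ∘ f) y :=
      ContinuousAt.comp (f := N.chart (f x) ∘ f)
        ((N.chart (f x)).continuousAt_symm ((N.chart (f x)).map_source hyx))
        (continuousAt_of_differentiableAt_chart hy)
    refine h1.congr ?_
    filter_upwards [hys] with z hz
    simp only [Function.comp_apply, (N.chart (f x)).left_inv hz]
  refine ⟨hc, ?_⟩
  have hyy := M.mem_chart_source y
  have h1 : DifferentiableAt ℝ (N.chart (f y) ∘ (N.chart (f x)).symm)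
      (((N.chart (f x) ∘ f) ∘ (M.chart y).symm) (M.chart y y)) := by
    simp only [Function.comp_apply, (M.chart y).left_inv hyy]
    exact (N.contDiffAt_transition hyx (N.mem_chart_source _)).differentiableAt (by simp)
  refine (h1.comp _ hy).congr_of_eventuallyEq ?_
  filter_upwards [tendsto_chart_symm hyy hys] with z hz
  have hz' : f ((M.chart y).symm z) ∈ (N.chart (f x)).source := hz
  simp only [Function.comp_apply, (N.chart (f x)).left_inv hz']

theorem DiffAt.differentiableAt_read {f : M → N} {p a : M} {b : N} (hf : DiffAt f p)
    (ha : p ∈ (M.chart a).source) (hb : f p ∈ (N.chart b).source) :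
    DifferentiableAt ℝ (N.chart b ∘ f ∘ (M.chart a).symm) (M.chart a p) := by
  refine differentiableAt_chart_read (f := N.chart b ∘ f) (M.mem_chart_source p) ha ?_
  have hp := M.mem_chart_source p
  have h1 : DifferentiableAt ℝ (N.chart b ∘ (N.chart (f p)).symm)
      ((N.chart (f p) ∘ f ∘ (M.chart p).symm) (M.chart p p)) := by
    simp only [Function.comp_apply, (M.chart p).left_inv hp]
    exact (N.contDiffAt_transition (N.mem_chart_source _) hb).differentiableAt (by simp)
  refine (h1.comp _ hf.2).congr_of_eventuallyEq ?_
  filter_upwards [tendsto_chart_symm hp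
    (hf.1 ((N.chart (f p)).open_source.mem_nhds (N.mem_chart_source _)))] with z hz
  have hz' : f ((M.chart p).symm z) ∈ (N.chart (f p)).source := hz
  simp only [Function.comp_apply, (N.chart (f p)).left_inv hz']

/-- The tangent map, read in arbitrary charts. -/
theorem coordChange_tanMap {f : M → N} {p a : M} {q b : N} (hf : DiffAt f p) (hq : f p = q)
    (ha : p ∈ (M.chart a).source) (hb : q ∈ (N.chart b).source) (v : M.TangentSp p) :
    N.coordChange b q (tanMap f hq v) =
      fderiv ℝ (N.chart b ∘ f ∘ (M.chart a).symm) (M.chart a p) (M.coordChange a p v) := by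
  obtain ⟨c, hc⟩ := exists_hasVelocity p v
  -- Both sides are the derivative of the same curve in the model space at `b`.
  have h1 := (hc.map hf hq).hasDerivAt_chart hb
  have h2 : HasDerivAt ((N.chart b ∘ f ∘ (M.chart a).symm) ∘ (M.chart a ∘ c))
      (fderiv ℝ (N.chart b ∘ f ∘ (M.chart a).symm) (M.chart a p)
        (M.coordChange a p v)) 0 :=
    (hf.differentiableAt_read ha (hq.symm ▸ hb)).hasFDerivAt.comp_hasDerivAt_of_eq
      (0 : ℝ) (hc.hasDerivAt_chart ha) (by simp only [Function.comp_apply, hc.map_zero])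
  refine h1.unique (h2.congr_of_eventuallyEq ?_)
  filter_upwards [hc.tendsto ((M.chart a).open_source.mem_nhds ha)] with τ hτ
  have hτ' : c τ ∈ (M.chart a).source := hτ
  simp only [Function.comp_apply, (M.chart a).left_inv hτ']

end NNHBanachManifold

/-! ### Lie brackets of vector fields -/

theorem extendByZero_of_mem {X : Type u} {A : X → Type w} [∀ x, Zero (A x)] {U : Set X}
    (σ : ∀ x : U, A x) {x : X} (hx : x ∈ U) : extendByZero U σ x = σ ⟨x, hx⟩ :=
  dif_pos hx

theorem two_le_contDiff_infty : (2 : WithTop ℕ∞) ≤ ∞ :=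
  WithTop.coe_le_coe.2 (le_top : (2 : ℕ∞) ≤ ⊤)

/-- Lie brackets of vector fields related by a smooth map are related by it. -/
theorem fderiv_lieBracket_of_related {E F : Type*} [NormedAddCommGroup E] [NormedSpace ℝ E]
    [NormedAddCommGroup F] [NormedSpace ℝ F] {f : E → F} {x : E} (hf : ContDiffAt ℝ ∞ f x)
    {V W : E → E} {V' W' : F → F} (hV : DifferentiableAt ℝ V x) (hW : DifferentiableAt ℝ W x)
    (hV' : DifferentiableAt ℝ V' (f x)) (hW' : DifferentiableAt ℝ W' (f x))
    (hVV' : ∀ᶠ z in 𝓝 x, fderiv ℝ f z (V z) = V' (f z))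
    (hWW' : ∀ᶠ z in 𝓝 x, fderiv ℝ f z (W z) = W' (f z)) :
    fderiv ℝ f x (VectorField.lieBracket ℝ V W x) = VectorField.lieBracket ℝ V' W' (f x) := by
  have hd : DifferentiableAt ℝ f x := hf.differentiableAt (by simp)
  have key : ∀ {Z : E → E} {Z' : F → F}, DifferentiableAt ℝ Z' (f x) →
      (∀ᶠ z in 𝓝 x, fderiv ℝ f z (Z z) = Z' (f z)) →
      fderiv ℝ (fun z => fderiv ℝ f z (Z z)) x = (fderiv ℝ Z' (f x)).comp (fderiv ℝ f x) := by
    intro Z Z' hZ' h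
    rw [Filter.EventuallyEq.fderiv_eq h]
    exact fderiv_comp x hZ' hd
  rw [VectorField.fderiv_apply_lieBracket hf (by simpa using two_le_contDiff_infty) hW hV,
    key hW' hWW', key hV' hVV']
  simp only [ContinuousLinearMap.comp_apply, hVV'.self_of_nhds, hWW'.self_of_nhds]
  rfl

namespace NNHBanachManifold

open Filter

variable {M : NNHBanachManifold.{u, v}} {N : NNHBanachManifold.{u', v'}}

/-- The representative of the vector field `X` in the chart `chart x`. -/
def localRep (x : M) (X : ∀ p : M, M.TangentSp p) (y : M.Model x) : M.Model x :=
  M.coordChange x ((M.chart x).symm y) (X ((M.chart x).symm y))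

theorem localRep_chart {x q : M} (hq : q ∈ (M.chart x).source) (X : ∀ p : M, M.TangentSp p) :
    localRep x X (M.chart x q) = M.coordChange x q (X q) :=
  congrArg (fun r => M.coordChange x r (X r)) ((M.chart x).left_inv hq)

theorem lieBracketAt_eq (X Y : ∀ p : M, M.TangentSp p) (p : M) :
    lieBracketAt X Y p = VectorField.lieBracket ℝ (localRep p X) (localRep p Y) (M.chart p p) :=
  rfl

theorem contDiffAt_localRep {X : ∀ p : M, M.TangentSp p} {p x : M}
    (hX : M.tangentBundle.SmoothSectionAt X p) (hp : p ∈ (M.chart x).source) :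
    ContDiffAt ℝ ∞ (localRep x X) (M.chart x p) :=
  (smoothFunAt_iff hp).1 (hX x hp)

theorem localRep_congr {X X' : ∀ p : M, M.TangentSp p} {p x : M} (hp : p ∈ (M.chart x).source)
    (h : ∀ᶠ q in 𝓝 p, X q = X' q) : localRep x X =ᶠ[𝓝 (M.chart x p)] localRep x X' := by
  filter_upwards [tendsto_chart_symm hp h] with z hz
  have hz' : X ((M.chart x).symm z) = X' ((M.chart x).symm z) := hz
  simp only [localRep, hz']

theorem lieBracketAt_congr {X X' Y Y' : ∀ p : M, M.TangentSp p} {p : M}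
    (hX : ∀ᶠ q in 𝓝 p, X q = X' q) (hY : ∀ᶠ q in 𝓝 p, Y q = Y' q) :
    lieBracketAt X Y p = lieBracketAt X' Y' p :=
  (localRep_congr (M.mem_chart_source p) hX).lieBracket_vectorField_eq
    (localRep_congr (M.mem_chart_source p) hY)

theorem smoothSectionAt_congr {B : M → Type w} [∀ x, NormedAddCommGroup (B x)]
    [∀ x, NormedSpace ℝ (B x)] [∀ x, CompleteSpace (B x)] (ℬ : BanachBundle M B)
    {σ σ' : ∀ p : M, B p} {p : M} (hσ : ℬ.SmoothSectionAt σ p)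
    (h : ∀ᶠ q in 𝓝 p, σ' q = σ q) : ℬ.SmoothSectionAt σ' p := by
  intro x₀ hx₀
  refine (hσ x₀ hx₀).congr_of_eventuallyEq ?_
  filter_upwards [h] with q hq
  rw [hq]

/-- Relatedness of vector fields, read in charts. -/
theorem fderiv_localRep_of_related {f : M → N} {p a : M} {b : N} (hf : SmoothAt f p)
    (ha : p ∈ (M.chart a).source) (hb : f p ∈ (N.chart b).source)
    {X : ∀ p : M, M.TangentSp p} {X' : ∀ p : N, N.TangentSp p}
    (h : ∀ᶠ q in 𝓝 p, tanMap f (rfl : f q = f q) (X q) = X' (f q)) :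
    ∀ᶠ z in 𝓝 (M.chart a p), fderiv ℝ (N.chart b ∘ f ∘ (M.chart a).symm) z (localRep a X z) =
      localRep b X' ((N.chart b ∘ f ∘ (M.chart a).symm) z) := by
  filter_upwards [tendsto_chart_symm ha h, tendsto_chart_symm ha hf.eventually_diffAt,
    tendsto_chart_symm ha (hf.1 ((N.chart b).open_source.mem_nhds hb)),
    (M.chart a).open_target.mem_nhds ((M.chart a).map_source ha)] with z hz hzd hzb hza
  obtain ⟨q, hq, rfl⟩ : ∃ q ∈ (M.chart a).source, M.chart a q = z :=
    ⟨_, (M.chart a).map_target hza, (M.chart a).right_inv hza⟩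
  have hinv := (M.chart a).left_inv hq
  have hz : tanMap f (rfl : f q = f q) (X q) = X' (f q) := by
    simp only [mem_preimage, hinv] at hz
    exact hz
  have hzd : DiffAt f q := by
    simp only [mem_preimage, hinv] at hzd
    exact hzd
  have hzb : f q ∈ (N.chart b).source := by
    simp only [mem_preimage, hinv] at hzb
    exact hzb
  rw [localRep_chart hq, ← coordChange_tanMap hzd rfl hq hzb, hz]
  simp only [Function.comp_apply, hinv]
  rw [localRep_chart hzb]

/-- Lie brackets of related vector fields are related, read in charts. -/
theorem fderiv_lieBracket_localRep_of_related {f : M → N} {p a : M} {b : N} (hf : SmoothAt f p)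
    (ha : p ∈ (M.chart a).source) (hb : f p ∈ (N.chart b).source)
    {X Y : ∀ p : M, M.TangentSp p} {X' Y' : ∀ p : N, N.TangentSp p}
    (hX : M.tangentBundle.SmoothSectionAt X p) (hY : M.tangentBundle.SmoothSectionAt Y p)
    (hX' : N.tangentBundle.SmoothSectionAt X' (f p))
    (hY' : N.tangentBundle.SmoothSectionAt Y' (f p))
    (hXX' : ∀ᶠ q in 𝓝 p, tanMap f (rfl : f q = f q) (X q) = X' (f q))
    (hYY' : ∀ᶠ q in 𝓝 p, tanMap f (rfl : f q = f q) (Y q) = Y' (f q)) :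
    fderiv ℝ (N.chart b ∘ f ∘ (M.chart a).symm) (M.chart a p)
        (VectorField.lieBracket ℝ (localRep a X) (localRep a Y) (M.chart a p)) =
      VectorField.lieBracket ℝ (localRep b X') (localRep b Y') (N.chart b (f p)) := by
  have hfp : (N.chart b ∘ f ∘ (M.chart a).symm) (M.chart a p) = N.chart b (f p) := by
    simp only [Function.comp_apply, (M.chart a).left_inv ha]
  have h := fderiv_lieBracket_of_related
    ((smoothFunAt_iff ha).1 (hf.smoothFunAt_chart_comp hb))
    ((contDiffAt_localRep hX ha).differentiableAt (by simp))
    ((contDiffAt_localRep hY ha).differentiableAt (by simp))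
    (V' := localRep b X') (W' := localRep b Y')
    (by
      change DifferentiableAt ℝ _ ((N.chart b ∘ f ∘ (M.chart a).symm) (M.chart a p))
      rw [hfp]
      exact (contDiffAt_localRep hX' hb).differentiableAt (by simp))
    (by
      change DifferentiableAt ℝ _ ((N.chart b ∘ f ∘ (M.chart a).symm) (M.chart a p))
      rw [hfp]
      exact (contDiffAt_localRep hY' hb).differentiableAt (by simp))
    (fderiv_localRep_of_related hf ha hb hXX') (fderiv_localRep_of_related hf ha hb hYY')
  rw [← hfp]
  exact h

/-- The Lie brackets at `p` and `f p` of vector fields related by `f` near `p` are related. -/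
theorem tanMap_lieBracketAt {f : M → N} {p : M} {y : N} (hf : SmoothAt f p) (hy : f p = y)
    {X Y : ∀ p : M, M.TangentSp p} {X' Y' : ∀ p : N, N.TangentSp p}
    (hX : M.tangentBundle.SmoothSectionAt X p) (hY : M.tangentBundle.SmoothSectionAt Y p)
    (hX' : N.tangentBundle.SmoothSectionAt X' y) (hY' : N.tangentBundle.SmoothSectionAt Y' y)
    (hXX' : ∀ᶠ q in 𝓝 p, tanMap f (rfl : f q = f q) (X q) = X' (f q))
    (hYY' : ∀ᶠ q in 𝓝 p, tanMap f (rfl : f q = f q) (Y q) = Y' (f q)) :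
    tanMap f hy (lieBracketAt X Y p) = lieBracketAt X' Y' y := by
  subst hy
  exact fderiv_lieBracket_localRep_of_related hf (M.mem_chart_source p) (N.mem_chart_source _)
    hX hY hX' hY' hXX' hYY'

theorem tanMap_id (p : M) (v : M.TangentSp p) :
    tanMap (fun q : M => q) (rfl : (fun q : M => q) p = p) v = v := by
  obtain ⟨c, hc⟩ := exists_hasVelocity p v
  exact (hc.map (smoothAt_id p).diffAt rfl).unique hc

/-- The Lie bracket may be computed in any chart. -/
theorem coordChange_lieBracketAt {X Y : ∀ p : M, M.TangentSp p} {p x : M}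
    (hX : M.tangentBundle.SmoothSectionAt X p) (hY : M.tangentBundle.SmoothSectionAt Y p)
    (hp : p ∈ (M.chart x).source) :
    M.coordChange x p (lieBracketAt X Y p) =
      VectorField.lieBracket ℝ (localRep x X) (localRep x Y) (M.chart x p) :=
  fderiv_lieBracket_localRep_of_related (f := fun q : M => q) (smoothAt_id p)
    (M.mem_chart_source p) hp hX hY hX hY
    (Eventually.of_forall fun q => tanMap_id q (X q))
    (Eventually.of_forall fun q => tanMap_id q (Y q))

theorem localRep_lieBracketAt {X Y : ∀ p : M, M.TangentSp p} {p x : M}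
    (hX : ∀ᶠ q in 𝓝 p, M.tangentBundle.SmoothSectionAt X q)
    (hY : ∀ᶠ q in 𝓝 p, M.tangentBundle.SmoothSectionAt Y q) (hp : p ∈ (M.chart x).source) :
    localRep x (lieBracketAt X Y) =ᶠ[𝓝 (M.chart x p)]
      VectorField.lieBracket ℝ (localRep x X) (localRep x Y) := by
  filter_upwards [tendsto_chart_symm hp hX, tendsto_chart_symm hp hY,
    (M.chart x).open_target.mem_nhds ((M.chart x).map_source hp)] with z hzX hzY hz
  have h := coordChange_lieBracketAt hzX hzY ((M.chart x).map_target hz)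
  rw [(M.chart x).right_inv hz] at h
  exact h

theorem smoothSectionAt_lieBracketAt {X Y : ∀ p : M, M.TangentSp p} {p : M}
    (hX : ∀ᶠ q in 𝓝 p, M.tangentBundle.SmoothSectionAt X q)
    (hY : ∀ᶠ q in 𝓝 p, M.tangentBundle.SmoothSectionAt Y q) :
    M.tangentBundle.SmoothSectionAt (lieBracketAt X Y) p := by
  intro x hp
  have hp : p ∈ (M.chart x).source := hp
  refine (smoothFunAt_iff hp).2 ?_
  exact ((contDiffAt_localRep hX.self_of_nhds hp).lieBracket_vectorField
    (contDiffAt_localRep hY.self_of_nhds hp) (m := ∞) (by simp)).congr_of_eventuallyEq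
    (localRep_lieBracketAt hX hY hp)

theorem lieBracketAt_zero (p : M) :
    lieBracketAt (0 : ∀ q : M, M.TangentSp q) 0 p = 0 := by
  have h : localRep p (0 : ∀ q : M, M.TangentSp q) = 0 := funext fun _ => map_zero _
  rw [lieBracketAt_eq, h, VectorField.lieBracket_zero_left]
  rfl

theorem smoothSectionAt_zero (p : M) :
    M.tangentBundle.SmoothSectionAt (0 : ∀ q : M, M.TangentSp q) p := by
  intro x _
  refine (smoothFunAt_const (0 : M.TangentSp x) p).congr_of_eventuallyEq ?_
  exact Eventually.of_forall fun q => map_zero _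

theorem localRep_add (x : M) (X Y : ∀ p : M, M.TangentSp p) :
    localRep x (X + Y) = localRep x X + localRep x Y :=
  funext fun _ => map_add _ _ _

theorem localRep_smul (x : M) (c : ℝ) (X : ∀ p : M, M.TangentSp p) :
    localRep x (c • X) = c • localRep x X :=
  funext fun _ => map_smul _ _ _

theorem lieBracketAt_swap (X Y : ∀ p : M, M.TangentSp p) (p : M) :
    lieBracketAt X Y p = -lieBracketAt Y X p :=
  VectorField.lieBracket_swap

theorem lieBracketAt_add_right {X Y Z : ∀ p : M, M.TangentSp p} {p : M}
    (hY : M.tangentBundle.SmoothSectionAt Y p) (hZ : M.tangentBundle.SmoothSectionAt Z p) :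
    lieBracketAt X (Y + Z) p = lieBracketAt X Y p + lieBracketAt X Z p := by
  rw [lieBracketAt_eq, localRep_add]
  exact VectorField.lieBracket_add_right
    ((contDiffAt_localRep hY (M.mem_chart_source p)).differentiableAt (by simp))
    ((contDiffAt_localRep hZ (M.mem_chart_source p)).differentiableAt (by simp))

theorem lieBracketAt_smul_right {X Y : ∀ p : M, M.TangentSp p} {p : M} (c : ℝ)
    (hY : M.tangentBundle.SmoothSectionAt Y p) :
    lieBracketAt X (c • Y) p = c • lieBracketAt X Y p := by
  rw [lieBracketAt_eq, localRep_smul]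
  exact VectorField.lieBracket_const_smul_right
    ((contDiffAt_localRep hY (M.mem_chart_source p)).differentiableAt (by simp))

theorem lieBracketAt_funSMul_right {X Y : ∀ p : M, M.TangentSp p} {p : M} {f : M → ℝ}
    (hf : SmoothFunAt f p) (hY : M.tangentBundle.SmoothSectionAt Y p) :
    lieBracketAt X (fun q => f q • Y q) p =
      f p • lieBracketAt X Y p + differential f p (X p) • Y p := by
  have hp := M.mem_chart_source p
  have hrep : localRep p (fun q => f q • Y q) =
      fun z => (f ∘ (M.chart p).symm) z • localRep p Y z :=
    funext fun _ => map_smul _ _ _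
  have hself : ∀ Z : (∀ q : M, M.TangentSp q), localRep p Z (M.chart p p) = Z p := by
    intro Z
    rw [localRep_chart hp]
    exact congrArg (fun L => L (Z p)) (M.fderiv_transition_self hp)
  rw [lieBracketAt_eq, hrep, VectorField.lieBracket_smul_right
    (ContDiffAt.differentiableAt hf (by simp))
    ((contDiffAt_localRep hY hp).differentiableAt (by simp)), hself, hself, add_comm]
  simp only [Function.comp_apply, (M.chart p).left_inv hp]
  rfl

theorem lieBracketAt_jacobi {X Y Z : ∀ p : M, M.TangentSp p} {p : M}
    (hX : ∀ᶠ q in 𝓝 p, M.tangentBundle.SmoothSectionAt X q)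
    (hY : ∀ᶠ q in 𝓝 p, M.tangentBundle.SmoothSectionAt Y q)
    (hZ : ∀ᶠ q in 𝓝 p, M.tangentBundle.SmoothSectionAt Z q) :
    lieBracketAt X (lieBracketAt Y Z) p + lieBracketAt Y (lieBracketAt Z X) p +
      lieBracketAt Z (lieBracketAt X Y) p = 0 := by
  have hp := M.mem_chart_source p
  have key : ∀ {A B C : ∀ p : M, M.TangentSp p},
      (∀ᶠ q in 𝓝 p, M.tangentBundle.SmoothSectionAt B q) →
      (∀ᶠ q in 𝓝 p, M.tangentBundle.SmoothSectionAt C q) →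
      lieBracketAt A (lieBracketAt B C) p = VectorField.lieBracket ℝ (localRep p A)
        (VectorField.lieBracket ℝ (localRep p B) (localRep p C)) (M.chart p p) :=
    fun hB hC => Filter.EventuallyEq.lieBracket_vectorField_eq (Filter.EventuallyEq.refl _ _)
      (localRep_lieBracketAt hB hC hp)
  have hsm : ∀ {A : ∀ p : M, M.TangentSp p},
      (∀ᶠ q in 𝓝 p, M.tangentBundle.SmoothSectionAt A q) →
      ContDiffAt ℝ (minSmoothness ℝ 2) (localRep p A) (M.chart p p) := by
    intro A hA
    refine (contDiffAt_localRep hA.self_of_nhds hp).of_le ?_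
    simpa only [minSmoothness_of_isRCLikeNormedField] using two_le_contDiff_infty
  have h := VectorField.leibniz_identity_lieBracket le_rfl (hsm hX) (hsm hY) (hsm hZ)
  rw [key hY hZ, key hZ hX, key hX hY, h]
  have e1 : VectorField.lieBracket ℝ (localRep p Z) (localRep p X) =
      -VectorField.lieBracket ℝ (localRep p X) (localRep p Z) :=
    funext fun _ => VectorField.lieBracket_swap
  have e2 := VectorField.lieBracket_swap (𝕜 := ℝ) (V := localRep p Z) (x := M.chart p p)
    (W := VectorField.lieBracket ℝ (localRep p X) (localRep p Y))
  have e3 : VectorField.lieBracket ℝ (localRep p Y)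
      (-VectorField.lieBracket ℝ (localRep p X) (localRep p Z)) (M.chart p p) =
      -VectorField.lieBracket ℝ (localRep p Y)
        (VectorField.lieBracket ℝ (localRep p X) (localRep p Z)) (M.chart p p) := by
    simp only [VectorField.lieBracket, fderiv_neg, Pi.neg_apply, map_neg,
      neg_apply]
    abel
  rw [e1, e3, e2]
  abel

theorem sections_smooth_near {U : Opens M} (X : M.tangentBundle.sections U) {p : M} (hp : p ∈ U) :
    ∀ᶠ q in 𝓝 p, M.tangentBundle.SmoothSectionAt
      (extendByZero (A := M.TangentSp) (U : Set M) X.1) q := by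
  filter_upwards [U.isOpen.mem_nhds hp] with q hq using X.2 ⟨q, hq⟩

theorem extendByZero_lieBracket {U : Opens M} (X Y : ∀ p : U, M.TangentSp (p : M)) {p : M}
    (hp : p ∈ U) :
    ∀ᶠ q in 𝓝 p, extendByZero (A := M.TangentSp) (U : Set M) (lieBracket X Y) q =
      lieBracketAt (extendByZero (A := M.TangentSp) (U : Set M) X)
        (extendByZero (A := M.TangentSp) (U : Set M) Y) q := by
  filter_upwards [U.isOpen.mem_nhds hp] with q hq
  rw [extendByZero_of_mem _ hq]
  rfl

theorem lieBracket_mem_sections {U : Opens M} (X Y : M.tangentBundle.sections U) :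
    lieBracket X.1 Y.1 ∈ M.tangentBundle.sections U := by
  intro x
  exact smoothSectionAt_congr _
    (smoothSectionAt_lieBracketAt (sections_smooth_near X x.2) (sections_smooth_near Y x.2))
    (extendByZero_lieBracket X.1 Y.1 x.2)

theorem extendByZero_add {U : Opens M} (X Y : ∀ p : U, M.TangentSp (p : M)) :
    extendByZero (A := M.TangentSp) (U : Set M) (X + Y) =
      extendByZero (A := M.TangentSp) (U : Set M) X +
        extendByZero (A := M.TangentSp) (U : Set M) Y := by
  funext p
  by_cases h : p ∈ (U : Set M) <;> simp [extendByZero, h]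

theorem extendByZero_smul {U : Opens M} (c : ℝ) (X : ∀ p : U, M.TangentSp (p : M)) :
    extendByZero (A := M.TangentSp) (U : Set M) (c • X) =
      c • extendByZero (A := M.TangentSp) (U : Set M) X := by
  funext p
  by_cases h : p ∈ (U : Set M) <;> simp [extendByZero, h]

/-- The Lie bracket of smooth vector fields on an open set. -/
def sectionBracket {U : Opens M} (X Y : M.tangentBundle.sections U) :
    M.tangentBundle.sections U :=
  ⟨lieBracket X.1 Y.1, lieBracket_mem_sections X Y⟩

theorem sectionBracket_swap {U : Opens M} (X Y : M.tangentBundle.sections U) :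
    sectionBracket X Y = -sectionBracket Y X :=
  Subtype.ext (funext fun _ => lieBracketAt_swap _ _ _)

theorem sectionBracket_add_right {U : Opens M} (X Y Z : M.tangentBundle.sections U) :
    sectionBracket X (Y + Z) = sectionBracket X Y + sectionBracket X Z := by
  refine Subtype.ext (funext fun p => ?_)
  change lieBracketAt _ (extendByZero _ (Y.1 + Z.1)) _ = lieBracketAt _ _ _ + lieBracketAt _ _ _
  rw [extendByZero_add, lieBracketAt_add_right (Y.2 p) (Z.2 p)]

theorem sectionBracket_smul_right {U : Opens M} (c : ℝ) (X Y : M.tangentBundle.sections U) :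
    sectionBracket X (c • Y) = c • sectionBracket X Y := by
  refine Subtype.ext (funext fun p => ?_)
  change lieBracketAt _ (extendByZero _ (c • Y.1)) _ = c • lieBracketAt _ _ _
  rw [extendByZero_smul, lieBracketAt_smul_right c (Y.2 p)]

theorem sectionBracket_add_left {U : Opens M} (X Y Z : M.tangentBundle.sections U) :
    sectionBracket (X + Y) Z = sectionBracket X Z + sectionBracket Y Z := by
  rw [sectionBracket_swap, sectionBracket_add_right, neg_add, ← sectionBracket_swap,
    ← sectionBracket_swap]

theorem sectionBracket_smul_left {U : Opens M} (c : ℝ) (X Y : M.tangentBundle.sections U) :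
    sectionBracket (c • X) Y = c • sectionBracket X Y := by
  rw [sectionBracket_swap, sectionBracket_smul_right, sectionBracket_swap X Y]
  exact (smul_neg c (sectionBracket Y X)).symm

theorem sectionBracket_jacobi {U : Opens M} (X Y Z : M.tangentBundle.sections U) :
    sectionBracket X (sectionBracket Y Z) + sectionBracket Y (sectionBracket Z X) +
      sectionBracket Z (sectionBracket X Y) = 0 := by
  have key : ∀ (A B C : M.tangentBundle.sections U) (p : U),
      (sectionBracket A (sectionBracket B C)).1 p =
        lieBracketAt (extendByZero (A := M.TangentSp) (U : Set M) A.1)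
          (lieBracketAt (extendByZero (A := M.TangentSp) (U : Set M) B.1)
            (extendByZero (A := M.TangentSp) (U : Set M) C.1)) p :=
    fun A B C p => lieBracketAt_congr (Eventually.of_forall fun _ => rfl)
      (extendByZero_lieBracket B.1 C.1 p.2)
  refine Subtype.ext (funext fun p => ?_)
  change (sectionBracket X (sectionBracket Y Z)).1 p + (sectionBracket Y (sectionBracket Z X)).1 p +
    (sectionBracket Z (sectionBracket X Y)).1 p = 0
  rw [key, key, key]
  exact lieBracketAt_jacobi (sections_smooth_near X p.2) (sections_smooth_near Y p.2)
    (sections_smooth_near Z p.2)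

end NNHBanachManifold

/-! ### Sections of Banach bundles -/

namespace BanachBundle

open NNHBanachManifold

variable {M : NNHBanachManifold.{u, v}} {A : M → Type w}
  [∀ x, NormedAddCommGroup (A x)] [∀ x, NormedSpace ℝ (A x)] [∀ x, CompleteSpace (A x)]
  {N : NNHBanachManifold.{u', v'}} {B : N → Type w'}
  [∀ x, NormedAddCommGroup (B x)] [∀ x, NormedSpace ℝ (B x)] [∀ x, CompleteSpace (B x)]

theorem inverse_triv_apply (𝒜 : BanachBundle M A) {x x₀ : M} (hx : x ∈ 𝒜.baseSet x₀) (v : A x) :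
    (𝒜.triv x₀ x).inverse (𝒜.triv x₀ x v) = v :=
  (𝒜.isInvertible_triv x₀ x hx).inverse_apply_eq.2 rfl

/-- A section is smooth at a point if it is so in one trivialization. -/
theorem smoothSectionAt_of_triv (𝒜 : BanachBundle M A) {σ : ∀ x, A x} {x x₀ : M}
    (hx : x ∈ 𝒜.baseSet x₀) (h : SmoothFunAt (fun p => 𝒜.triv x₀ p (σ p)) x) :
    𝒜.SmoothSectionAt σ x := by
  intro x₁ hx₁
  refine ((𝒜.smooth_transition x₀ x₁ x ⟨hx, hx₁⟩).clm_apply h).congr_of_eventuallyEq ?_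
  filter_upwards [(𝒜.isOpen_baseSet x₀).mem_nhds hx] with p hp
  rw [ContinuousLinearMap.comp_apply, 𝒜.inverse_triv_apply hp]

theorem IsMorphism.smoothFunAt {𝒜 : BanachBundle M A} {ℬ : BanachBundle N B} {φ : M → N}
    {T : ∀ x, A x →L[ℝ] B (φ x)} (hT : 𝒜.IsMorphism ℬ φ T) {σ : ∀ x, A x} {x : M} {y₀ : N}
    (hσ : 𝒜.SmoothSectionAt σ x) (hy₀ : φ x ∈ ℬ.baseSet y₀) :
    SmoothFunAt (fun p => ℬ.triv y₀ (φ p) (T p (σ p))) x := by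
  have hx := 𝒜.mem_baseSet x
  refine ((hT.2 x y₀ x hx hy₀).clm_apply (hσ x hx)).congr_of_eventuallyEq ?_
  filter_upwards [(𝒜.isOpen_baseSet x).mem_nhds hx] with p hp
  simp only [ContinuousLinearMap.comp_apply, 𝒜.inverse_triv_apply hp]

end BanachBundle

/-! ### Submersions -/

section

variable {E F : Type*} [NormedAddCommGroup E] [NormedSpace ℝ E] [CompleteSpace E]
    [NormedAddCommGroup F] [NormedSpace ℝ F] [CompleteSpace F]

/-- A surjective operator together with a projection onto its kernel is an isomorphism. -/
theorem isInvertible_prod_of_surjective {f : E →L[ℝ] F} (hf : Function.Surjective f)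
    {P : E →L[ℝ] LinearMap.ker f.toLinearMap}
    (hP : ∀ v : LinearMap.ker f.toLinearMap, P v = v) : (P.prod f).IsInvertible := by
  have := ContinuousLinearMap.completeSpace_ker f
  have hinj : LinearMap.ker (P.prod f).toLinearMap = ⊥ := by
    refine LinearMap.ker_eq_bot'.2 fun v hv => ?_
    have hv' : (P v, f v) = 0 := hv
    have h1 : P v = 0 := congrArg Prod.fst hv'
    have h2 : f v = 0 := congrArg Prod.snd hv'
    have h3 := hP ⟨v, h2⟩
    exact congrArg Subtype.val (h3.symm.trans h1)
  have hsurj : LinearMap.range (P.prod f).toLinearMap = ⊤ := by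
    refine LinearMap.range_eq_top.2 fun kw => ?_
    obtain ⟨v, hv⟩ := hf kw.2
    refine ⟨v + (kw.1 - P v : LinearMap.ker f.toLinearMap), Prod.ext ?_ ?_⟩
    · change P (v + _) = kw.1
      rw [map_add, hP]
      abel
    · change f (v + _) = kw.2
      have h : f ((kw.1 - P v : LinearMap.ker f.toLinearMap) : E) = 0 :=
        (kw.1 - P v : LinearMap.ker f.toLinearMap).2
      rw [map_add, h, hv, add_zero]
  exact ⟨ContinuousLinearEquiv.ofBijective _ hinj hsurj,
    ContinuousLinearEquiv.coe_ofBijective _ hinj hsurj⟩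

/-- A smooth map with surjective derivative and split kernel has a smooth local section. -/
theorem ContDiffAt.exists_section {f : E → F} {a : E} (hf : ContDiffAt ℝ ∞ f a)
    (hsurj : Function.Surjective (fderiv ℝ f a))
    (hker : (LinearMap.ker (fderiv ℝ f a).toLinearMap).ClosedComplemented) :
    ∃ ψ : F → E, ContDiffAt ℝ ∞ ψ (f a) ∧ ψ (f a) = a ∧ ∀ᶠ y in 𝓝 (f a), f (ψ y) = y := by
  obtain ⟨P, hP⟩ := hker
  obtain ⟨e, he⟩ := isInvertible_prod_of_surjective hsurj hP
  -- `R` is a right inverse of the derivative; `f` is inverted along the affine space `a + R F`.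
  let R : F →L[ℝ] E := (e.symm : (LinearMap.ker (fderiv ℝ f a).toLinearMap × F) →L[ℝ] E).comp
    (ContinuousLinearMap.inr ℝ _ F)
  have hR : (fderiv ℝ f a).comp R = ContinuousLinearMap.id ℝ F := by
    ext y
    have h : (P.prod (fderiv ℝ f a)) (e.symm (0, y)) = (0, y) := by
      rw [← he]
      exact e.apply_symm_apply _
    exact congrArg Prod.snd h
  let g : F → F := fun y => f (a + R (y - f a))
  have hga : g (f a) = f a := by simp [g]
  have hin : ContDiffAt ℝ ∞ (fun y => a + R (y - f a)) (f a) := by fun_prop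
  have hg : ContDiffAt ℝ ∞ g (f a) :=
    ContDiffAt.comp (g := f) (f a) (by simpa using hf) hin
  have hg' : HasFDerivAt g ((ContinuousLinearEquiv.refl ℝ F : F ≃L[ℝ] F) : F →L[ℝ] F) (f a) := by
    have h1 : HasFDerivAt (fun y => a + R (y - f a)) R (f a) :=
      (R.hasFDerivAt.comp (f a) ((hasFDerivAt_id (f a)).sub_const (f a))).const_add a
    have h2 : HasFDerivAt f (fderiv ℝ f a) (a + R (f a - f a)) := by
      simpa using (hf.differentiableAt (by simp)).hasFDerivAt
    have h3 := h2.comp (f a) h1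
    rw [hR] at h3
    exact h3
  have h0 : (∞ : WithTop ℕ∞) ≠ 0 := by simp
  have hloc := hg.to_localInverse hg' h0
  have himg := hg.localInverse_apply_image hg' h0
  have hright : ∀ᶠ y in 𝓝 (g (f a)), g (hg.localInverse hg' h0 y) = y :=
    (hg.hasStrictFDerivAt' hg' h0).eventually_right_inverse
  rw [hga] at hloc himg hright
  refine ⟨fun y => a + R (hg.localInverse hg' h0 y - f a), ?_, by simp [himg], hright⟩
  exact ContDiffAt.comp (g := fun y => a + R (y - f a)) (f a) (by fun_prop) hloc

/-- Vectors in the kernel of the derivative are velocities of curves in the fibre. -/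
theorem exists_curve_in_fibre {f : E → F} {a : E} (hf : ContDiffAt ℝ ∞ f a)
    (hsurj : Function.Surjective (fderiv ℝ f a))
    (hker : (LinearMap.ker (fderiv ℝ f a).toLinearMap).ClosedComplemented) {v : E}
    (hv : fderiv ℝ f a v = 0) :
    ∃ γ : ℝ → E, γ 0 = a ∧ HasDerivAt γ v 0 ∧ ∀ᶠ τ in 𝓝 0, f (γ τ) = f a := by
  have hs : HasStrictFDerivAt f (fderiv ℝ f a) a := hf.hasStrictFDerivAt (by simp)
  have hsurj' := LinearMap.range_eq_top.2 hsurj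
  let k : LinearMap.ker (fderiv ℝ f a).toLinearMap := ⟨v, hv⟩
  have hk : HasDerivAt (fun τ : ℝ => τ • k) k 0 := by
    simpa using (hasDerivAt_id (0 : ℝ)).smul_const k
  refine ⟨fun τ => hs.implicitFunctionOfComplemented f _ hsurj' hker (f a) (τ • k), ?_, ?_, ?_⟩
  · simp
  · exact (hs.to_implicitFunctionOfComplemented hsurj' hker).hasFDerivAt.comp_hasDerivAt_of_eq
      (0 : ℝ) hk (by simp)
  · have ht : Filter.Tendsto (fun τ : ℝ => (f a, τ • k)) (𝓝 0)
        (𝓝 (f a, (0 : LinearMap.ker (fderiv ℝ f a).toLinearMap))) := by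
      have : ContinuousAt (fun τ : ℝ => (f a, τ • k)) 0 :=
        continuousAt_const.prodMk hk.continuousAt
      simpa [ContinuousAt] using this
    exact ht.eventually (hs.map_implicitFunctionOfComplemented_eq hsurj' hker)

end

namespace NNHBanachManifold

open Filter

variable {M : NNHBanachManifold.{u, v}} {N : NNHBanachManifold.{u', v'}}

/-- Submersions have smooth local sections. -/
theorem IsSubmersion.exists_section {f : M → N} (hf : IsSubmersion f) (p : M) :
    ∃ σ : N → M, SmoothAt σ (f p) ∧ σ (f p) = p ∧ ∀ᶠ y in 𝓝 (f p), f (σ y) = y := by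
  have hp := M.mem_chart_source p
  have hfp := N.mem_chart_source (f p)
  have hφ : (N.chart (f p) ∘ f ∘ (M.chart p).symm) (M.chart p p) = N.chart (f p) (f p) := by
    simp only [Function.comp_apply, (M.chart p).left_inv hp]
  obtain ⟨ψ, hψ, hψp, hψr⟩ := ContDiffAt.exists_section (hf.smooth.2 p)
    (hf.tanMap_surjective p) (hf.ker_split p)
  rw [hφ] at hψ hψp hψr
  have hsm : SmoothFunAt (ψ ∘ N.chart (f p)) (f p) :=
    SmoothFunAt.comp_contDiffAt (g := ψ) hψ (smoothFunAt_chart hfp)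
  have hval : (ψ ∘ N.chart (f p)) (f p) = M.chart p p := hψp
  have hσ : SmoothAt ((M.chart p).symm ∘ (ψ ∘ N.chart (f p))) (f p) :=
    smoothAt_chart_symm_comp hsm (hval ▸ (M.chart p).map_source hp)
  have hσp : ((M.chart p).symm ∘ (ψ ∘ N.chart (f p))) (f p) = p := by
    rw [Function.comp_apply, hval, (M.chart p).left_inv hp]
  refine ⟨_, hσ, hσp, ?_⟩
  have hcont : Tendsto (fun y => f (((M.chart p).symm ∘ (ψ ∘ N.chart (f p))) y)) (𝓝 (f p))
      (𝓝 (f p)) := by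
    have h : ContinuousAt (f ∘ ((M.chart p).symm ∘ (ψ ∘ N.chart (f p)))) (f p) :=
      ContinuousAt.comp hf.smooth.1.continuousAt hσ.1
    rw [ContinuousAt, Function.comp_apply, hσp] at h
    exact h
  filter_upwards [((N.chart (f p)).continuousAt hfp).eventually hψr,
    hcont ((N.chart (f p)).open_source.mem_nhds hfp),
    (N.chart (f p)).open_source.mem_nhds hfp] with y hy hy1 hy2
  exact (N.chart (f p)).injOn hy1 hy2 hy

/-- Vectors tangent to the fibre of a submersion are velocities of curves in the fibre. -/
theorem IsSubmersion.exists_hasVelocity {f : M → N} (hf : IsSubmersion f) {p : M}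
    {v : M.TangentSp p} (hv : tanMap f (rfl : f p = f p) v = 0) :
    ∃ c, HasVelocity c p v ∧ ∀ᶠ τ in 𝓝 0, f (c τ) = f p := by
  have hp := M.mem_chart_source p
  have hfp := N.mem_chart_source (f p)
  obtain ⟨γ, hγ0, hγ, hγf⟩ := exists_curve_in_fibre (hf.smooth.2 p)
    (hf.tanMap_surjective p) (hf.ker_split p) hv
  have hc := hasVelocity_chart_symm hγ0 hγ
  refine ⟨_, hc, ?_⟩
  have hcont : Tendsto (fun τ => f (((M.chart p).symm ∘ γ) τ)) (𝓝 0) (𝓝 (f p)) :=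
    (hf.smooth.1.tendsto p).comp hc.tendsto
  filter_upwards [hγf, hcont ((N.chart (f p)).open_source.mem_nhds hfp)] with τ hτ hτ1
  refine (N.chart (f p)).injOn hτ1 hfp ?_
  simpa only [Function.comp_apply, (M.chart p).left_inv hp] using hτ

end NNHBanachManifold

/-! ### Smoothness of the structure maps of a Banach-Lie groupoid -/

namespace NNHBanachLieGroupoid

open Filter NNHBanachManifold

variable (𝓖 : NNHBanachLieGroupoid.{u, v, u', v'})

/-- The multiplication, read in charts, is the restriction of a smooth map. -/
theorem exists_local_mul {g h p : 𝓖.G} (hgh : 𝓖.src g = 𝓖.tgt h) (hp : 𝓖.mul g h = p) :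
    ∃ F : 𝓖.G.Model g × 𝓖.G.Model h → 𝓖.G.Model p,
      ContDiffAt ℝ ∞ F (𝓖.G.chart g g, 𝓖.G.chart h h) ∧
      ∀ᶠ q : 𝓖.G × 𝓖.G in 𝓝 (g, h), 𝓖.src q.1 = 𝓖.tgt q.2 →
        𝓖.mul q.1 q.2 ∈ (𝓖.G.chart p).source ∧
        𝓖.G.chart p (𝓖.mul q.1 q.2) = F (𝓖.G.chart g q.1, 𝓖.G.chart h q.2) := by
  subst hp
  obtain ⟨W, F, hW, hmem, hF, hmul⟩ := 𝓖.mul_smooth g h hgh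
  have hg := 𝓖.G.mem_chart_source g
  have hh := 𝓖.G.mem_chart_source h
  refine ⟨F, hF.contDiffAt (hW.mem_nhds hmem), ?_⟩
  have h1 : ∀ᶠ q : 𝓖.G × 𝓖.G in 𝓝 (g, h), q.1 ∈ (𝓖.G.chart g).source :=
    continuousAt_fst ((𝓖.G.chart g).open_source.mem_nhds hg)
  have h2 : ∀ᶠ q : 𝓖.G × 𝓖.G in 𝓝 (g, h), q.2 ∈ (𝓖.G.chart h).source :=
    continuousAt_snd ((𝓖.G.chart h).open_source.mem_nhds hh)
  have h3 : ContinuousAt (fun q : 𝓖.G × 𝓖.G => (𝓖.G.chart g q.1, 𝓖.G.chart h q.2)) (g, h) :=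
    (ContinuousAt.comp (f := Prod.fst) ((𝓖.G.chart g).continuousAt hg) continuousAt_fst).prodMk
      (ContinuousAt.comp (f := Prod.snd) ((𝓖.G.chart h).continuousAt hh) continuousAt_snd)
  filter_upwards [h1, h2, h3 (hW.mem_nhds hmem)] with q hq1 hq2 hq3 hq
  exact hmul q.1 hq1 q.2 hq2 hq3 hq

theorem tendsto_mul {ι : Type*} {l : Filter ι} {a b : ι → 𝓖.G} {g h : 𝓖.G}
    (ha : Tendsto a l (𝓝 g)) (hb : Tendsto b l (𝓝 h)) (hgh : 𝓖.src g = 𝓖.tgt h)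
    (hab : ∀ᶠ i in l, 𝓖.src (a i) = 𝓖.tgt (b i)) :
    Tendsto (fun i => 𝓖.mul (a i) (b i)) l (𝓝 (𝓖.mul g h)) :=
  (𝓖.toTop.mul_continuousOn (g, h) hgh).tendsto.comp
    (tendsto_nhdsWithin_iff.2 ⟨ha.prodMk_nhds hb, hab⟩)

theorem smoothAt_mul {N : NNHBanachManifold.{w, w'}} {a b : N → 𝓖.G} {q : N}
    (ha : SmoothAt a q) (hb : SmoothAt b q) (hab : ∀ᶠ r in 𝓝 q, 𝓖.src (a r) = 𝓖.tgt (b r)) :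
    SmoothAt (fun r => 𝓖.mul (a r) (b r)) q := by
  obtain ⟨F, hF, hmul⟩ := 𝓖.exists_local_mul hab.self_of_nhds rfl
  refine ⟨𝓖.tendsto_mul ha.1 hb.1 hab.self_of_nhds hab, ?_⟩
  have h : SmoothFunAt (fun r => F (𝓖.G.chart (a q) (a r), 𝓖.G.chart (b q) (b r))) q :=
    SmoothFunAt.comp_contDiffAt hF (SmoothFunAt.prodMk ha.2 hb.2)
  refine h.congr_of_eventuallyEq ?_
  filter_upwards [(ha.1.prodMk_nhds hb.1).eventually hmul, hab] with r hr hr'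
  exact (hr hr').2

theorem inv_inv (g : 𝓖.G) : 𝓖.toTop.inv (𝓖.toTop.inv g) = g := by
  let i := 𝓖.toTop.inv
  have h1 : 𝓖.src (i (i g)) = 𝓖.src g := (𝓖.toTop.src_inv _).trans (𝓖.toTop.tgt_inv g)
  calc i (i g) = 𝓖.mul (i (i g)) (𝓖.one (𝓖.src (i (i g)))) := (𝓖.toTop.mul_one _).symm
    _ = 𝓖.mul (i (i g)) (𝓖.mul (i g) g) := by rw [h1]; exact congrArg _ (𝓖.toTop.inv_mul g).symm
    _ = 𝓖.mul (𝓖.mul (i (i g)) (i g)) g :=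
      (𝓖.toTop.mul_assoc _ _ _ (𝓖.toTop.src_inv _) (𝓖.toTop.src_inv g)).symm
    _ = 𝓖.mul (𝓖.one (𝓖.tgt g)) g :=
      congrArg (fun k => 𝓖.mul k g) ((𝓖.toTop.inv_mul (i g)).trans
        (congrArg 𝓖.one (𝓖.toTop.src_inv g)))
    _ = g := 𝓖.toTop.one_mul g

theorem smoothAt_src (g : 𝓖.G) : SmoothAt 𝓖.src g :=
  𝓖.src_isSubmersion.smooth.smoothAt g

theorem smoothAt_tgt (g : 𝓖.G) : SmoothAt 𝓖.tgt g :=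
  ((𝓖.smoothAt_src (𝓖.toTop.inv g)).comp (𝓖.inv_smooth.smoothAt g)).congr_of_eventuallyEq
    (Eventually.of_forall fun k => (𝓖.toTop.src_inv k).symm)

/-- Through every arrow passes a smooth local section of the target map. -/
theorem exists_tgt_section (g : 𝓖.G) : ∃ γ : 𝓖.M → 𝓖.G, SmoothAt γ (𝓖.tgt g) ∧
    γ (𝓖.tgt g) = g ∧ ∀ᶠ y in 𝓝 (𝓖.tgt g), 𝓖.tgt (γ y) = y := by
  obtain ⟨σ, hσ, hσg, hσs⟩ := 𝓖.src_isSubmersion.exists_section (𝓖.toTop.inv g)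
  rw [𝓖.toTop.src_inv] at hσ hσg hσs
  refine ⟨𝓖.toTop.inv ∘ σ, (𝓖.inv_smooth.smoothAt _).comp hσ, ?_, ?_⟩
  · rw [Function.comp_apply, hσg, 𝓖.inv_inv]
  · filter_upwards [hσs] with y hy
    exact (𝓖.toTop.tgt_inv _).trans hy

/-- The identity section is smooth: locally it is `g⁻¹ g`, for `g` running through a smooth local
section of the source map. -/
theorem smoothAt_one (x : 𝓖.M) : SmoothAt 𝓖.one x := by
  obtain ⟨σ, hσ, -, hσs⟩ := 𝓖.src_isSubmersion.exists_section (𝓖.one x)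
  rw [𝓖.toTop.src_one] at hσ hσs
  have h : SmoothAt (fun y => 𝓖.mul (𝓖.toTop.inv (σ y)) (σ y)) x :=
    𝓖.smoothAt_mul ((𝓖.inv_smooth.smoothAt _).comp hσ) hσ
      (Eventually.of_forall fun y => 𝓖.toTop.src_inv _)
  refine h.congr_of_eventuallyEq ?_
  filter_upwards [hσs] with y hy
  exact ((𝓖.toTop.inv_mul (σ y)).trans (congrArg 𝓖.one hy)).symm

/-! ### Tangent maps of right translations -/

theorem mem_kerTsrc {g : 𝓖.G} {v : 𝓖.G.TangentSp g} :
    v ∈ 𝓖.kerTsrc g ↔ tanMap 𝓖.src (rfl : 𝓖.src g = 𝓖.src g) v = 0 :=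
  LinearMap.mem_ker

theorem exists_hasVelocity_of_mem_kerTsrc {g : 𝓖.G} {v : 𝓖.G.TangentSp g}
    (hv : v ∈ 𝓖.kerTsrc g) :
    ∃ c, HasVelocity c g v ∧ ∀ᶠ τ in 𝓝 0, 𝓖.src (c τ) = 𝓖.src g :=
  𝓖.src_isSubmersion.exists_hasVelocity (𝓖.mem_kerTsrc.1 hv)

theorem mem_kerTsrc_of_hasVelocity {c : ℝ → 𝓖.G} {g : 𝓖.G} {v : 𝓖.G.TangentSp g}
    (hc : HasVelocity c g v) (hs : ∀ᶠ τ in 𝓝 0, 𝓖.src (c τ) = 𝓖.src g) : v ∈ 𝓖.kerTsrc g :=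
  𝓖.mem_kerTsrc.2 ((hc.map (𝓖.smoothAt_src g).diffAt rfl).unique
    ((hasVelocity_const (𝓖.src g)).congr_of_eventuallyEq hs))

/-- The tangent map at `h` of the right translation by `g`, with values in the tangent space at a
point `p` that is (propositionally) equal to `h g`. -/
def rightTransl (h g p : 𝓖.G) : 𝓖.G.TangentSp h →L[ℝ] 𝓖.G.TangentSp p :=
  fderivWithin ℝ (𝓖.G.chart p ∘ (fun k => 𝓖.mul k g) ∘ (𝓖.G.chart h).symm)
    ((𝓖.G.chart h).target ∩ (𝓖.G.chart h).symm ⁻¹' {k | 𝓖.src k = 𝓖.tgt g}) (𝓖.G.chart h h)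

/-- Right translation carries the velocity of a curve in a fibre of the source map to the velocity
of the translated curve. -/
theorem hasVelocity_mul_right {c : ℝ → 𝓖.G} {h g p : 𝓖.G} {v : 𝓖.G.TangentSp h}
    (hc : HasVelocity c h v) (hs : ∀ᶠ τ in 𝓝 0, 𝓖.src (c τ) = 𝓖.tgt g) (hp : 𝓖.mul h g = p) :
    HasVelocity (fun τ => 𝓖.mul (c τ) g) p (𝓖.rightTransl h g p v) := by
  have hhg : 𝓖.src h = 𝓖.tgt g := hc.map_zero ▸ hs.self_of_nhds
  have hh := 𝓖.G.mem_chart_source h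
  have hinv := (𝓖.G.chart h).left_inv hh
  have hcg : ContinuousAt (fun τ => 𝓖.mul (c τ) g) 0 := by
    have := 𝓖.tendsto_mul hc.tendsto tendsto_const_nhds hhg hs
    rwa [ContinuousAt, hc.map_zero]
  refine ⟨by rw [hc.map_zero, hp], hcg, ?_⟩
  obtain ⟨F, hF, hmul⟩ := 𝓖.exists_local_mul hhg hp
  set S := (𝓖.G.chart h).target ∩ (𝓖.G.chart h).symm ⁻¹' {k | 𝓖.src k = 𝓖.tgt g} with hS
  have hFd : DifferentiableAt ℝ (fun z => F (z, 𝓖.G.chart g g)) (𝓖.G.chart h h) :=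
    (hF.differentiableAt (by simp)).comp (f := fun z => (z, 𝓖.G.chart g g)) _
      (differentiableAt_id.prodMk (differentiableAt_const _))
  have hpair : Tendsto (fun z => ((𝓖.G.chart h).symm z, g)) (𝓝 (𝓖.G.chart h h)) (𝓝 (h, g)) :=
    (tendsto_chart_symm hh).prodMk_nhds tendsto_const_nhds
  have heq : 𝓖.G.chart p ∘ (fun k => 𝓖.mul k g) ∘ (𝓖.G.chart h).symm
      =ᶠ[𝓝[S] (𝓖.G.chart h h)] fun z => F (z, 𝓖.G.chart g g) := by
    filter_upwards [self_mem_nhdsWithin, nhdsWithin_le_nhds (hpair hmul)] with z hzS hz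
    have hz' := (hz hzS.2).2
    dsimp only at hz'
    rwa [(𝓖.G.chart h).right_inv hzS.1] at hz'
  have hxS : 𝓖.G.chart h h ∈ S := ⟨(𝓖.G.chart h).map_source hh, by
    simpa only [mem_preimage, hinv, mem_ofPred_eq] using hhg⟩
  have hD : HasFDerivWithinAt (𝓖.G.chart p ∘ (fun k => 𝓖.mul k g) ∘ (𝓖.G.chart h).symm)
      (𝓖.rightTransl h g p) S (𝓖.G.chart h h) :=
    (hFd.differentiableWithinAt.congr_of_eventuallyEq heq
      (heq.self_of_nhdsWithin hxS)).hasFDerivWithinAt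
  have hT : {τ | 𝓖.src (c τ) = 𝓖.tgt g ∧ c τ ∈ (𝓖.G.chart h).source} ∈ 𝓝 (0 : ℝ) :=
    hs.and (hc.tendsto ((𝓖.G.chart h).open_source.mem_nhds hh))
  have hcomp := HasFDerivWithinAt.comp_hasDerivWithinAt_of_eq (0 : ℝ) hD
    (hc.hasDerivAt.hasDerivWithinAt
      (s := {τ | 𝓖.src (c τ) = 𝓖.tgt g ∧ c τ ∈ (𝓖.G.chart h).source}))
    (fun τ hτ => ⟨(𝓖.G.chart h).map_source hτ.2, by
      simpa only [mem_preimage, Function.comp_apply, (𝓖.G.chart h).left_inv hτ.2,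
        mem_ofPred_eq] using hτ.1⟩)
    (by simp only [Function.comp_apply, hc.map_zero])
  refine (hcomp.hasDerivAt hT).congr_of_eventuallyEq ?_
  filter_upwards [hT] with τ hτ
  simp only [Function.comp_apply, (𝓖.G.chart h).left_inv hτ.2]

/-! ### Right-invariant extensions of sections -/

/-- The right-invariant extension of the section `X`: its value at `g` is the right translate by `g`
of the value of `X` at the target of `g`. -/
def rightExt (X : ∀ x : 𝓖.M, 𝓖.AFiber x) (g : 𝓖.G) : 𝓖.G.TangentSp g :=
  𝓖.rightTransl (𝓖.one (𝓖.tgt g)) g g (X (𝓖.tgt g))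

variable {𝓖} (X : ∀ x : 𝓖.M, 𝓖.AFiber x)

theorem hasVelocity_rightExt {g : 𝓖.G} {c : ℝ → 𝓖.G}
    (hc : HasVelocity c (𝓖.one (𝓖.tgt g)) (X (𝓖.tgt g) : 𝓖.G.TangentSp _))
    (hs : ∀ᶠ τ in 𝓝 0, 𝓖.src (c τ) = 𝓖.tgt g) :
    HasVelocity (fun τ => 𝓖.mul (c τ) g) g (𝓖.rightExt X g) :=
  𝓖.hasVelocity_mul_right hc hs (𝓖.toTop.one_mul g)

theorem exists_fibre_curve (x : 𝓖.M) (v : 𝓖.AFiber x) :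
    ∃ c, HasVelocity c (𝓖.one x) (v : 𝓖.G.TangentSp _) ∧ ∀ᶠ τ in 𝓝 0, 𝓖.src (c τ) = x := by
  obtain ⟨c, hc, hs⟩ := 𝓖.exists_hasVelocity_of_mem_kerTsrc v.2
  exact ⟨c, hc, hs.mono fun τ hτ => hτ.trans (𝓖.toTop.src_one x)⟩

theorem rightExt_mem_kerTsrc (g : 𝓖.G) : 𝓖.rightExt X g ∈ 𝓖.kerTsrc g := by
  obtain ⟨c, hc, hs⟩ := exists_fibre_curve (𝓖.tgt g) (X (𝓖.tgt g))
  exact 𝓖.mem_kerTsrc_of_hasVelocity (hasVelocity_rightExt X hc hs)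
    (hs.mono fun τ hτ => 𝓖.toTop.src_mul _ _ hτ)

theorem rightExt_mul {h g : 𝓖.G} (hg : 𝓖.src h = 𝓖.tgt g) :
    𝓖.rightExt X (𝓖.mul h g) = 𝓖.tangentRightMul h g (𝓖.rightExt X h) := by
  have key : ∀ x, x = 𝓖.tgt h → 𝓖.rightTransl (𝓖.one x) (𝓖.mul h g) (𝓖.mul h g) (X x) =
      𝓖.rightTransl h g (𝓖.mul h g) (𝓖.rightExt X h) := by
    rintro x rfl
    obtain ⟨c, hc, hs⟩ := exists_fibre_curve (𝓖.tgt h) (X (𝓖.tgt h))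
    have h1 := 𝓖.hasVelocity_mul_right (hasVelocity_rightExt X hc hs) (g := g)
      (hs.mono fun τ hτ => (𝓖.toTop.src_mul _ _ hτ).trans hg) rfl
    have h2 := 𝓖.hasVelocity_mul_right hc (g := 𝓖.mul h g) (p := 𝓖.mul h g)
      (hs.mono fun τ hτ => hτ.trans (𝓖.toTop.tgt_mul h g hg).symm)
      (by
        have := 𝓖.toTop.one_mul (𝓖.mul h g)
        rwa [𝓖.toTop.tgt_mul h g hg] at this)
    exact h2.unique (h1.congr_of_eventuallyEq
      (hs.mono fun τ hτ => (𝓖.toTop.mul_assoc _ _ _ hτ hg).symm))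
  exact key _ (𝓖.toTop.tgt_mul h g hg)

theorem rightTransl_one (x : 𝓖.M) (v : 𝓖.AFiber x) :
    𝓖.rightTransl (𝓖.one x) (𝓖.one x) (𝓖.one x) v = v := by
  obtain ⟨c, hc, hs⟩ := exists_fibre_curve x v
  have hone : ∀ k, 𝓖.src k = x → 𝓖.mul k (𝓖.one x) = k := by
    rintro k rfl
    exact 𝓖.toTop.mul_one k
  exact (𝓖.hasVelocity_mul_right hc (hs.mono fun τ hτ => hτ.trans (𝓖.toTop.tgt_one x).symm)
    (hone _ (𝓖.toTop.src_one x))).unique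
      (hc.congr_of_eventuallyEq (hs.mono fun τ hτ => hone _ hτ))

theorem rightExt_one (x : 𝓖.M) : 𝓖.rightExt X (𝓖.one x) = X x := by
  have key : ∀ y, y = x → 𝓖.rightTransl (𝓖.one y) (𝓖.one x) (𝓖.one x) (X y) = X x := by
    rintro y rfl
    exact rightTransl_one y (X y)
  exact key _ (𝓖.toTop.tgt_one x)

theorem tanMap_tgt_rightExt (g : 𝓖.G) :
    tanMap 𝓖.tgt (rfl : 𝓖.tgt g = 𝓖.tgt g) (𝓖.rightExt X g) =
      𝓖.anchor (𝓖.tgt g) (X (𝓖.tgt g)) := by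
  obtain ⟨c, hc, hs⟩ := exists_fibre_curve (𝓖.tgt g) (X (𝓖.tgt g))
  have h1 := (hasVelocity_rightExt X hc hs).map (𝓖.smoothAt_tgt g).diffAt rfl
  have h2 := hc.map (𝓖.smoothAt_tgt _).diffAt (𝓖.toTop.tgt_one (𝓖.tgt g))
  exact h1.unique (h2.congr_of_eventuallyEq (hs.mono fun τ hτ => 𝓖.toTop.tgt_mul _ _ hτ))

/-- The right-invariant extension of a smooth section is smooth. -/
theorem smoothSectionAt_rightExt {g : 𝓖.G}
    (hX : SmoothFunAt (fun x => 𝓖.G.coordChange (𝓖.one (𝓖.tgt g)) (𝓖.one x)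
      (X x : 𝓖.G.TangentSp (𝓖.one x))) (𝓖.tgt g)) :
    𝓖.G.tangentBundle.SmoothSectionAt (𝓖.rightExt X) g := by
  have hg := 𝓖.G.mem_chart_source g
  refine BanachBundle.smoothSectionAt_of_triv _ (x₀ := g) hg ?_
  set e := 𝓖.one (𝓖.tgt g) with he
  obtain ⟨F, hF, hmul⟩ := 𝓖.exists_local_mul (𝓖.toTop.src_one (𝓖.tgt g)) (𝓖.toTop.one_mul g)
  have hot : SmoothAt (𝓖.one ∘ 𝓖.tgt) g := (𝓖.smoothAt_one _).comp (𝓖.smoothAt_tgt g)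
  have hpt : SmoothFunAt (fun k => (𝓖.G.chart e (𝓖.one (𝓖.tgt k)), 𝓖.G.chart g k)) g :=
    SmoothFunAt.prodMk hot.2 (smoothFunAt_chart hg)
  have hvec : SmoothFunAt (fun k => (𝓖.G.coordChange e (𝓖.one (𝓖.tgt k))
      (X (𝓖.tgt k) : 𝓖.G.TangentSp (𝓖.one (𝓖.tgt k))), (0 : 𝓖.G.Model g))) g :=
    SmoothFunAt.prodMk (SmoothFunAt.comp hX (𝓖.smoothAt_tgt g)) (smoothFunAt_const _ _)
  have hDF : SmoothFunAt (fun k => fderiv ℝ F (𝓖.G.chart e (𝓖.one (𝓖.tgt k)), 𝓖.G.chart g k)) g :=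
    SmoothFunAt.comp_contDiffAt (g := fderiv ℝ F) (hF.fderiv_right (by simp)) hpt
  refine (hDF.clm_apply hvec).congr_of_eventuallyEq ?_
  have hFd : ∀ᶠ k in 𝓝 g, DifferentiableAt ℝ F
      (𝓖.G.chart e (𝓖.one (𝓖.tgt k)), 𝓖.G.chart g k) :=
    hpt.continuousAt.eventually (((hF.of_le (m := 1) (by exact_mod_cast le_top)).eventually
      (by simp)).mono fun z hz => hz.differentiableAt (by simp))
  have hmul' : ∀ᶠ k in 𝓝 g, ∀ᶠ q : 𝓖.G × 𝓖.G in 𝓝 (𝓖.one (𝓖.tgt k), k),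
      𝓖.src q.1 = 𝓖.tgt q.2 → 𝓖.mul q.1 q.2 ∈ (𝓖.G.chart g).source ∧
        𝓖.G.chart g (𝓖.mul q.1 q.2) = F (𝓖.G.chart e q.1, 𝓖.G.chart g q.2) :=
    (hot.1.prodMk_nhds continuousAt_id).eventually hmul.eventually_nhds
  filter_upwards [hFd, hmul', (𝓖.G.chart g).open_source.mem_nhds hg,
    hot.1 ((𝓖.G.chart e).open_source.mem_nhds (𝓖.G.mem_chart_source e))] with k hkd hk hkg hke
  -- Both sides are the derivative of `τ ↦ chart g (c τ * k)`, for a curve `c` with velocity `X`.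
  obtain ⟨c, hc, hs⟩ := exists_fibre_curve (𝓖.tgt k) (X (𝓖.tgt k))
  have h1 := (hasVelocity_rightExt X hc hs).hasDerivAt_chart hkg
  have h2 : HasDerivAt (fun τ => F (𝓖.G.chart e (c τ), 𝓖.G.chart g k))
      (fderiv ℝ F (𝓖.G.chart e (𝓖.one (𝓖.tgt k)), 𝓖.G.chart g k)
        (𝓖.G.coordChange e (𝓖.one (𝓖.tgt k)) (X (𝓖.tgt k) : 𝓖.G.TangentSp _), 0)) 0 :=
    hkd.hasFDerivAt.comp_hasDerivAt_of_eq (f := fun τ => (𝓖.G.chart e (c τ), 𝓖.G.chart g k))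
      (0 : ℝ) ((hc.hasDerivAt_chart hke).prodMk (hasDerivAt_const _ _)) (by rw [hc.map_zero])
  refine h1.unique (h2.congr_of_eventuallyEq ?_)
  filter_upwards [(hc.tendsto.prodMk_nhds (tendsto_const_nhds (x := k))).eventually hk,
    hs] with τ hτ hτs
  exact (hτ hτs).2

/-! ### The Lie bracket of right-invariant vector fields -/

theorem lieBracketAt_mem_kerTsrc {X Y : ∀ g : 𝓖.G, 𝓖.G.TangentSp g} {g : 𝓖.G}
    (hX : 𝓖.G.tangentBundle.SmoothSectionAt X g) (hY : 𝓖.G.tangentBundle.SmoothSectionAt Y g)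
    (hXs : ∀ᶠ k in 𝓝 g, X k ∈ 𝓖.kerTsrc k) (hYs : ∀ᶠ k in 𝓝 g, Y k ∈ 𝓖.kerTsrc k) :
    lieBracketAt X Y g ∈ 𝓖.kerTsrc g := by
  refine 𝓖.mem_kerTsrc.2 ?_
  rw [tanMap_lieBracketAt (X' := 0) (Y' := 0) (𝓖.smoothAt_src g) rfl hX hY
    (smoothSectionAt_zero _) (smoothSectionAt_zero _) (hXs.mono fun k hk => 𝓖.mem_kerTsrc.1 hk)
    (hYs.mono fun k hk => 𝓖.mem_kerTsrc.1 hk), lieBracketAt_zero]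

/-- Brackets of right-invariant vector fields are right-invariant.  The right translation by `g` is
only defined on a fibre of the source map; it is extended to the smooth map
`k ↦ k γ(s(k))` near `h`, for a local section `γ` of the target map through `g`; this map preserves
right-invariant vector fields. -/
theorem lieBracketAt_mul {X Y : ∀ g : 𝓖.G, 𝓖.G.TangentSp g} {O : Set 𝓖.G} (hO : IsOpen O)
    {h g : 𝓖.G} (hh : h ∈ O) (hhg : 𝓖.src h = 𝓖.tgt g)
    (hX : ∀ k ∈ O, 𝓖.G.tangentBundle.SmoothSectionAt X k)
    (hY : ∀ k ∈ O, 𝓖.G.tangentBundle.SmoothSectionAt Y k)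
    (hX' : 𝓖.G.tangentBundle.SmoothSectionAt X (𝓖.mul h g))
    (hY' : 𝓖.G.tangentBundle.SmoothSectionAt Y (𝓖.mul h g))
    (hXs : ∀ k ∈ O, X k ∈ 𝓖.kerTsrc k) (hYs : ∀ k ∈ O, Y k ∈ 𝓖.kerTsrc k)
    (hXm : ∀ k ∈ O, ∀ l, 𝓖.src k = 𝓖.tgt l → X (𝓖.mul k l) = 𝓖.tangentRightMul k l (X k))
    (hYm : ∀ k ∈ O, ∀ l, 𝓖.src k = 𝓖.tgt l → Y (𝓖.mul k l) = 𝓖.tangentRightMul k l (Y k)) :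
    lieBracketAt X Y (𝓖.mul h g) = 𝓖.tangentRightMul h g (lieBracketAt X Y h) := by
  have hOh := hO.mem_nhds hh
  obtain ⟨γ, hγ, hγg, hγt⟩ := 𝓖.exists_tgt_section g
  rw [← hhg] at hγ hγg hγt
  have hcomp : ∀ᶠ k in 𝓝 h, 𝓖.src k = 𝓖.tgt (γ (𝓖.src k)) :=
    (𝓖.smoothAt_src h).1.eventually (hγt.mono fun y hy => hy.symm)
  have hR : SmoothAt (fun k => 𝓖.mul k (γ (𝓖.src k))) h :=
    𝓖.smoothAt_mul (smoothAt_id h) (hγ.comp (𝓖.smoothAt_src h)) hcomp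
  have hRh : (fun k => 𝓖.mul k (γ (𝓖.src k))) h = 𝓖.mul h g := congrArg (𝓖.mul h) hγg
  -- On vectors tangent to the fibres, the tangent map is the one of a right translation, because
  -- `γ ∘ s` is constant along curves in a fibre.
  have key : ∀ {k l p : 𝓖.G} {v : 𝓖.G.TangentSp k}, DiffAt (fun k => 𝓖.mul k (γ (𝓖.src k))) k →
      v ∈ 𝓖.kerTsrc k → 𝓖.src k = 𝓖.tgt l → γ (𝓖.src k) = l →
      ∀ hp : 𝓖.mul k (γ (𝓖.src k)) = p,
      tanMap (fun k => 𝓖.mul k (γ (𝓖.src k))) hp v = 𝓖.rightTransl k l p v := by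
    intro k l p v hd hv hkl hl hp
    obtain ⟨c, hc, hs⟩ := 𝓖.exists_hasVelocity_of_mem_kerTsrc hv
    refine (hc.map hd hp).unique ((𝓖.hasVelocity_mul_right hc
      (hs.mono fun τ hτ => hτ.trans hkl) (hl ▸ hp)).congr_of_eventuallyEq ?_)
    filter_upwards [hs] with τ hτ
    simp only [Function.comp_apply, hτ, hl]
  have hrel : ∀ {Z : ∀ g : 𝓖.G, 𝓖.G.TangentSp g}, (∀ k ∈ O, Z k ∈ 𝓖.kerTsrc k) →
      (∀ k ∈ O, ∀ l, 𝓖.src k = 𝓖.tgt l → Z (𝓖.mul k l) = 𝓖.tangentRightMul k l (Z k)) →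
      ∀ᶠ k in 𝓝 h, tanMap (fun k => 𝓖.mul k (γ (𝓖.src k)))
        (rfl : (fun k => 𝓖.mul k (γ (𝓖.src k))) k = (fun k => 𝓖.mul k (γ (𝓖.src k))) k) (Z k) =
        Z ((fun k => 𝓖.mul k (γ (𝓖.src k))) k) := by
    intro Z hZs hZm
    filter_upwards [hOh, hcomp, hR.eventually_diffAt] with k hk hkc hkd
    exact (key hkd (hZs k hk) hkc rfl rfl).trans (hZm k hk _ hkc).symm
  rw [← tanMap_lieBracketAt hR hRh (hX h hh) (hY h hh) hX' hY' (hrel hXs hXm) (hrel hYs hYm)]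
  exact key hR.diffAt (lieBracketAt_mem_kerTsrc (hX h hh) (hY h hh)
    (Filter.mem_of_superset hOh hXs) (Filter.mem_of_superset hOh hYs)) hhg hγg hRh

end NNHBanachLieGroupoid

/-! ### The pullback bundle of `ker Ts` by the identity section -/

namespace NNHBanachLieGroupoid

open Filter NNHBanachManifold

variable (𝓖 : NNHBanachLieGroupoid.{u, v, u', v'})

/-- A continuous projection onto the fibre of the pullback bundle at `x`. -/
def kerProj (x : 𝓖.M) : 𝓖.G.TangentSp (𝓖.one x) →L[ℝ] 𝓖.AFiber x :=
  (𝓖.src_isSubmersion.ker_split (𝓖.one x)).choose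

theorem kerProj_apply (x : 𝓖.M) (v : 𝓖.AFiber x) : 𝓖.kerProj x v = v :=
  (𝓖.src_isSubmersion.ker_split (𝓖.one x)).choose_spec v

/-- The tangent map of the source map at `1_x`, read in the charts at `1_{x₀}` and `x₀`. -/
def srcDeriv (x₀ x : 𝓖.M) : 𝓖.G.Model (𝓖.one x₀) →L[ℝ] 𝓖.M.Model x₀ :=
  fderiv ℝ (𝓖.M.chart x₀ ∘ 𝓖.src ∘ (𝓖.G.chart (𝓖.one x₀)).symm)
    (𝓖.G.chart (𝓖.one x₀) (𝓖.one x))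

/-- The map that pairs the projection onto `ker T_{1_{x₀}} s` with the tangent map of the source map
at `1_x`.  It is an isomorphism for `x` near `x₀`, and then maps `ker T_{1_x} s`, read in the chart,
onto the first factor. -/
def splitting (x₀ x : 𝓖.M) : 𝓖.G.Model (𝓖.one x₀) →L[ℝ] 𝓖.AFiber x₀ × 𝓖.M.Model x₀ :=
  (𝓖.kerProj x₀).prod (𝓖.srcDeriv x₀ x)

theorem isInvertible_splitting_self (x : 𝓖.M) : (𝓖.splitting x x).IsInvertible := by
  have key : ∀ {y : 𝓖.M} (hy : 𝓖.src (𝓖.one x) = y),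
      ((𝓖.kerProj x).prod (tanMap 𝓖.src hy)).IsInvertible := by
    rintro y rfl
    exact isInvertible_prod_of_surjective (𝓖.src_isSubmersion.tanMap_surjective (𝓖.one x))
      (𝓖.kerProj_apply x)
  exact key (𝓖.toTop.src_one x)

/-- The tangent map along the identity section of a smooth map, read in charts, depends smoothly on
the base point. -/
theorem smoothFunAt_fderiv_one {N : NNHBanachManifold.{w, w'}} {f : 𝓖.G → N} {x : 𝓖.M}
    {a : 𝓖.G} {b : N} (hf : SmoothAt f (𝓖.one x)) (ha : 𝓖.one x ∈ (𝓖.G.chart a).source)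
    (hb : f (𝓖.one x) ∈ (N.chart b).source) :
    SmoothFunAt (fun p => fderiv ℝ (N.chart b ∘ f ∘ (𝓖.G.chart a).symm)
      (𝓖.G.chart a (𝓖.one p))) x :=
  SmoothFunAt.comp_contDiffAt (f := 𝓖.G.chart a ∘ 𝓖.one)
    (g := fderiv ℝ (N.chart b ∘ f ∘ (𝓖.G.chart a).symm))
    (((smoothFunAt_iff ha).1 (hf.smoothFunAt_chart_comp hb)).fderiv_right (by simp))
    ((𝓖.smoothAt_one x).smoothFunAt_chart_comp ha)

theorem smoothFunAt_splitting {x₀ x : 𝓖.M} (hx : x ∈ (𝓖.M.chart x₀).source)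
    (hx' : 𝓖.one x ∈ (𝓖.G.chart (𝓖.one x₀)).source) : SmoothFunAt (𝓖.splitting x₀) x := by
  have h : SmoothFunAt (𝓖.srcDeriv x₀) x :=
    𝓖.smoothFunAt_fderiv_one (𝓖.smoothAt_src _) hx'
      ((congrArg (fun y => y ∈ (𝓖.M.chart x₀).source) (𝓖.toTop.src_one x)).mpr hx)
  have h' : SmoothFunAt (fun p => (ContinuousLinearMap.inl ℝ (𝓖.AFiber x₀) (𝓖.M.Model x₀)).comp
      (𝓖.kerProj x₀) + (ContinuousLinearMap.inr ℝ (𝓖.AFiber x₀) (𝓖.M.Model x₀)).comp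
      (𝓖.srcDeriv x₀ p)) x :=
    ContDiffAt.add (smoothFunAt_const _ x) ((smoothFunAt_const _ x).clm_comp h)
  refine h'.congr_of_eventuallyEq (Eventually.of_forall fun p =>
    ContinuousLinearMap.ext fun v => ?_)
  exact Prod.ext (add_zero _).symm (zero_add _).symm

/-- The domain of the trivialization around `x₀`. -/
def trivSet (x₀ : 𝓖.M) : Set 𝓖.M :=
  {x | x ∈ (𝓖.M.chart x₀).source ∧ 𝓖.one x ∈ (𝓖.G.chart (𝓖.one x₀)).source ∧
    (𝓖.splitting x₀ x).IsInvertible}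

theorem isOpen_trivSet (x₀ : 𝓖.M) : IsOpen (𝓖.trivSet x₀) := by
  refine isOpen_iff_mem_nhds.2 fun x hx => ?_
  obtain ⟨h1, h2, e, he⟩ := hx
  have hc := (𝓖.smoothFunAt_splitting h1 h2).continuousAt
  have hinv : ∀ᶠ p in 𝓝 x, (𝓖.splitting x₀ p).IsInvertible := by
    rw [ContinuousAt, ← he] at hc
    exact hc e.nhds
  filter_upwards [(𝓖.M.chart x₀).open_source.mem_nhds h1,
    (𝓖.smoothAt_one x).1 ((𝓖.G.chart (𝓖.one x₀)).open_source.mem_nhds h2), hinv] with p h1 h2 h3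
  exact ⟨h1, h2, h3⟩

theorem mem_trivSet (x₀ : 𝓖.M) : x₀ ∈ 𝓖.trivSet x₀ :=
  ⟨𝓖.M.mem_chart_source x₀, 𝓖.G.mem_chart_source _, 𝓖.isInvertible_splitting_self x₀⟩

/-- The trivialization around `x₀`: a vector tangent to the fibre of the source map at `1_x` is read
in the chart at `1_{x₀}` and projected onto `ker T_{1_{x₀}} s`. -/
def fibreTriv (x₀ x : 𝓖.M) : 𝓖.AFiber x →L[ℝ] 𝓖.AFiber x₀ :=
  (𝓖.kerProj x₀).comp ((𝓖.G.coordChange (𝓖.one x₀) (𝓖.one x)).comp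
    (𝓖.kerTsrc (𝓖.one x)).subtypeL)

theorem mem_kerTsrc_one_iff {x₀ x : 𝓖.M} (hx : x ∈ 𝓖.trivSet x₀)
    (v : 𝓖.G.TangentSp (𝓖.one x)) : v ∈ 𝓖.kerTsrc (𝓖.one x) ↔
      𝓖.srcDeriv x₀ x (𝓖.G.coordChange (𝓖.one x₀) (𝓖.one x) v) = 0 := by
  have hs : 𝓖.src (𝓖.one x) ∈ (𝓖.M.chart x₀).source :=
    (congrArg (fun y => y ∈ (𝓖.M.chart x₀).source) (𝓖.toTop.src_one x)).mpr hx.1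
  rw [srcDeriv, ← coordChange_tanMap (𝓖.smoothAt_src (𝓖.one x)).diffAt rfl hx.2.1 hs,
    map_eq_zero_iff _ (coordChange_injective hs), mem_kerTsrc]

theorem splitting_coordChange {x₀ x : 𝓖.M} (hx : x ∈ 𝓖.trivSet x₀) (v : 𝓖.AFiber x) :
    𝓖.splitting x₀ x (𝓖.G.coordChange (𝓖.one x₀) (𝓖.one x) v) = (𝓖.fibreTriv x₀ x v, 0) :=
  Prod.ext rfl ((𝓖.mem_kerTsrc_one_iff hx v).1 v.2)

theorem isInvertible_fibreTriv {x₀ x : 𝓖.M} (hx : x ∈ 𝓖.trivSet x₀) :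
    (𝓖.fibreTriv x₀ x).IsInvertible := by
  obtain ⟨e, he⟩ := hx.2.2
  have hinj : LinearMap.ker (𝓖.fibreTriv x₀ x).toLinearMap = ⊥ := by
    refine LinearMap.ker_eq_bot'.2 fun v hv => ?_
    have hv' : 𝓖.fibreTriv x₀ x v = 0 := hv
    have h := 𝓖.splitting_coordChange hx v
    rw [hv', ← he] at h
    have h1 : 𝓖.G.coordChange (𝓖.one x₀) (𝓖.one x) v = 0 := e.map_eq_zero_iff.1 h
    exact Subtype.ext ((map_eq_zero_iff _ (coordChange_injective hx.2.1)).1 h1)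
  have hsurj : LinearMap.range (𝓖.fibreTriv x₀ x).toLinearMap = ⊤ := by
    refine LinearMap.range_eq_top.2 fun k => ?_
    obtain ⟨v, hv⟩ := (𝓖.G.coordChangeEquiv hx.2.1).surjective (e.symm (k, 0))
    have hv' : 𝓖.G.coordChange (𝓖.one x₀) (𝓖.one x) v = e.symm (k, 0) := hv
    have h : 𝓖.splitting x₀ x (𝓖.G.coordChange (𝓖.one x₀) (𝓖.one x) v) = (k, 0) := by
      rw [hv', ← he]
      exact e.apply_symm_apply _
    exact ⟨⟨v, (𝓖.mem_kerTsrc_one_iff hx v).2 (congrArg Prod.snd h)⟩, congrArg Prod.fst h⟩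
  exact ⟨ContinuousLinearEquiv.ofBijective _ hinj hsurj,
    ContinuousLinearEquiv.coe_ofBijective _ hinj hsurj⟩

/-- The inverse trivializations, read in a chart of `G`, are given by the inverse of `splitting`. -/
theorem coordChange_inverse_fibreTriv {x₀ x : 𝓖.M} (hx : x ∈ 𝓖.trivSet x₀) (k : 𝓖.AFiber x₀) :
    𝓖.G.coordChange (𝓖.one x₀) (𝓖.one x) ((𝓖.fibreTriv x₀ x).inverse k : 𝓖.AFiber x) =
      (𝓖.splitting x₀ x).inverse (k, 0) := by
  obtain ⟨e, he⟩ := 𝓖.isInvertible_fibreTriv hx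
  have h := 𝓖.splitting_coordChange hx ((𝓖.fibreTriv x₀ x).inverse k)
  have hk : 𝓖.fibreTriv x₀ x ((𝓖.fibreTriv x₀ x).inverse k) = k := by
    rw [← he, ContinuousLinearMap.inverse_equiv]
    exact e.apply_symm_apply k
  rw [hk] at h
  exact (hx.2.2.inverse_apply_eq.2 h.symm).symm

/-- The tangent maps along the identity section of a smooth map, restricted to the fibres of the
pullback bundle, depend smoothly on the base point. -/
theorem smoothFunAt_tanMap_one {N : NNHBanachManifold.{w, w'}} {f : 𝓖.G → N}
    (hf : ∀ g, SmoothAt f g) {φ : 𝓖.M → N} (hφ : ∀ x, f (𝓖.one x) = φ x) {x x₀ : 𝓖.M} {b : N}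
    (hx : x ∈ 𝓖.trivSet x₀) (hb : φ x ∈ (N.chart b).source) :
    SmoothFunAt (fun p => ((N.coordChange b (φ p)).comp ((tanMap f (hφ p)).comp
      (𝓖.kerTsrc (𝓖.one p)).subtypeL)).comp (𝓖.fibreTriv x₀ p).inverse) x := by
  have h1 := 𝓖.smoothFunAt_fderiv_one (hf _) hx.2.1 ((hφ x).symm ▸ hb)
  have h2 : SmoothFunAt (fun p => (𝓖.splitting x₀ p).inverse) x :=
    SmoothFunAt.comp_contDiffAt hx.2.2.contDiffAt_map_inverse
      (𝓖.smoothFunAt_splitting hx.1 hx.2.1)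
  have h3 := h1.clm_comp (h2.clm_comp
    (smoothFunAt_const (ContinuousLinearMap.inl ℝ (𝓖.AFiber x₀) (𝓖.M.Model x₀)) x))
  refine h3.congr_of_eventuallyEq ?_
  have hφc : ContinuousAt φ x :=
    ((hf _).1.comp (𝓖.smoothAt_one x).1).congr (Eventually.of_forall hφ)
  filter_upwards [(𝓖.isOpen_trivSet x₀).mem_nhds hx,
    hφc ((N.chart b).open_source.mem_nhds hb)] with p hp hpb
  ext k
  have h := coordChange_tanMap (hf (𝓖.one p)).diffAt (hφ p) hp.2.1 hpb
    ((𝓖.fibreTriv x₀ p).inverse k : 𝓖.AFiber p)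
  rw [𝓖.coordChange_inverse_fibreTriv hp] at h
  exact h

theorem smoothFunAt_subtype {x x₀ : 𝓖.M} {a : 𝓖.G} (hx : x ∈ 𝓖.trivSet x₀)
    (ha : 𝓖.one x ∈ (𝓖.G.chart a).source) :
    SmoothFunAt (fun p => ((𝓖.G.coordChange a (𝓖.one p)).comp
      (𝓖.kerTsrc (𝓖.one p)).subtypeL).comp (𝓖.fibreTriv x₀ p).inverse) x := by
  refine (𝓖.smoothFunAt_tanMap_one (f := fun g => g) smoothAt_id (φ := 𝓖.one) (fun _ => rfl) hx
    ha).congr_of_eventuallyEq (Eventually.of_forall fun p => ?_)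
  ext k
  exact congrArg (𝓖.G.coordChange a (𝓖.one p)) (tanMap_id _ _).symm

/-- The pullback bundle of `ker Ts` by the identity section. -/
def pullbackBundle : BanachBundle 𝓖.M 𝓖.AFiber where
  baseSet := 𝓖.trivSet
  isOpen_baseSet := 𝓖.isOpen_trivSet
  mem_baseSet := 𝓖.mem_trivSet
  triv := 𝓖.fibreTriv
  isInvertible_triv _ _ := 𝓖.isInvertible_fibreTriv
  smooth_transition _ x₁ x hx :=
    (smoothFunAt_const (𝓖.kerProj x₁) x).clm_comp (𝓖.smoothFunAt_subtype hx.1 hx.2.2.1)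

theorem isPullbackBundle_pullbackBundle : 𝓖.IsPullbackBundle 𝓖.pullbackBundle :=
  ⟨smooth_of_smoothAt 𝓖.smoothAt_one, fun _ _ _ hx hy => 𝓖.smoothFunAt_subtype hx hy⟩

theorem isMorphism_anchor :
    𝓖.pullbackBundle.IsMorphism 𝓖.M.tangentBundle id 𝓖.anchor :=
  ⟨smooth_of_smoothAt smoothAt_id, fun _ _ _ hx hy =>
    𝓖.smoothFunAt_tanMap_one 𝓖.smoothAt_tgt (φ := id) 𝓖.toTop.tgt_one hx hy⟩

end NNHBanachLieGroupoid

/-! ### Sections of the pullback bundle and right-invariant vector fields -/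

theorem NNHBanachManifold.differential_comp {M : NNHBanachManifold.{u, v}}
    {N : NNHBanachManifold.{u', v'}} {φ : N → ℝ} {f : M → N} {p : M} {q : N}
    (hφ : NNHBanachManifold.SmoothFunAt φ q) (hf : NNHBanachManifold.SmoothAt f p) (hq : f p = q)
    (v : M.TangentSp p) :
    NNHBanachManifold.differential (φ ∘ f) p v =
      NNHBanachManifold.differential φ q (NNHBanachManifold.tanMap f hq v) := by
  subst hq
  obtain ⟨c, hc⟩ := NNHBanachManifold.exists_hasVelocity p v
  have h1 := hc.hasDerivAt_of_hasFDerivAt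
    (ContDiffAt.differentiableAt (hφ.comp hf) (by simp)).hasFDerivAt
  have h2 := (hc.map hf.diffAt rfl).hasDerivAt_of_hasFDerivAt
    (ContDiffAt.differentiableAt hφ (by simp)).hasFDerivAt
  exact h1.unique h2

namespace NNHBanachLieGroupoid

open Filter NNHBanachManifold

variable {𝓖 : NNHBanachLieGroupoid.{u, v, u', v'}} {U V : Opens 𝓖.M}

/-- The extension by zero to all of `M` of a section over `U`. -/
abbrev extSection (X : 𝓖.pullbackBundle.sections U) : ∀ x : 𝓖.M, 𝓖.AFiber x :=
  extendByZero (U : Set 𝓖.M) X.1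

/-- The extension by zero to all of `G` of a vector field over `t⁻¹(U)`. -/
abbrev extField (X : 𝓖.G.tangentBundle.sections (𝓖.arrowsInto U)) : ∀ g : 𝓖.G, 𝓖.G.TangentSp g :=
  extendByZero (A := 𝓖.G.TangentSp) (𝓖.arrowsInto U : Set 𝓖.G) X.1

theorem rightExt_congr {X Y : ∀ x : 𝓖.M, 𝓖.AFiber x} {g : 𝓖.G}
    (h : X (𝓖.tgt g) = Y (𝓖.tgt g)) : 𝓖.rightExt X g = 𝓖.rightExt Y g := by
  rw [rightExt, h, rightExt]

theorem extendByZero_rightExt (X : 𝓖.pullbackBundle.sections U) :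
    extendByZero (A := 𝓖.G.TangentSp) (𝓖.arrowsInto U : Set 𝓖.G)
      (fun g => 𝓖.rightExt (extSection X) g) = 𝓖.rightExt (extSection X) := by
  funext g
  by_cases hg : g ∈ (𝓖.arrowsInto U : Set 𝓖.G)
  · exact extendByZero_of_mem _ hg
  · have h0 : extSection X (𝓖.tgt g) = 0 := dif_neg hg
    rw [rightExt, h0, extendByZero, dif_neg hg]
    exact (map_zero _).symm

theorem smoothSectionAt_rightExt_extSection (X : 𝓖.pullbackBundle.sections U) {g : 𝓖.G}
    (hg : 𝓖.tgt g ∈ U) : 𝓖.G.tangentBundle.SmoothSectionAt (𝓖.rightExt (extSection X)) g :=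
  smoothSectionAt_rightExt _ (𝓖.isPullbackBundle_pullbackBundle.smoothFunAt (X.2 ⟨_, hg⟩)
    (𝓖.G.mem_chart_source _))

theorem rightExt_mem_sections (X : 𝓖.pullbackBundle.sections U) :
    (fun g : 𝓖.arrowsInto U => 𝓖.rightExt (extSection X) (g : 𝓖.G)) ∈
      𝓖.G.tangentBundle.sections (𝓖.arrowsInto U) :=
  fun g => smoothSectionAt_congr _ (smoothSectionAt_rightExt_extSection X g.2)
    (Eventually.of_forall fun k => congrFun (extendByZero_rightExt X) k)

/-- The right-invariant vector field on `t⁻¹(U)` that extends the section `X` over `U`. -/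
def rightExtSection (X : 𝓖.pullbackBundle.sections U) : 𝓖.rightInvariant U :=
  ⟨⟨_, rightExt_mem_sections X⟩, fun g => rightExt_mem_kerTsrc (extSection X) (g : 𝓖.G),
    fun h g hg => rightExt_mul (extSection X) (h := (h : 𝓖.G)) (g := g) hg⟩

theorem extField_rightExtSection (X : 𝓖.pullbackBundle.sections U) :
    extField (rightExtSection X).1 = 𝓖.rightExt (extSection X) :=
  extendByZero_rightExt X

theorem rightExtSection_one (X : 𝓖.pullbackBundle.sections U) (x : U) :
    (rightExtSection X).1.1 (𝓖.oneInto x) = (X.1 x : 𝓖.G.TangentSp (𝓖.one x)) := by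
  have h : extSection X x = X.1 x := extendByZero_of_mem _ x.2
  rw [← h]
  exact rightExt_one _ _

/-- The restriction of a right-invariant vector field to the identity arrows. -/
def restrictOne (Y : 𝓖.rightInvariant U) : 𝓖.pullbackBundle.sections U :=
  ⟨fun x => ⟨Y.1.1 (𝓖.oneInto x), Y.2.1 (𝓖.oneInto x)⟩, fun x => by
    refine 𝓖.pullbackBundle.smoothSectionAt_of_triv (𝓖.mem_trivSet x) ?_
    have h1 : SmoothFunAt (fun g => 𝓖.G.coordChange (𝓖.one x) g (extField Y.1 g)) (𝓖.one x) :=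
      Y.1.2 (𝓖.oneInto x) (𝓖.one x) (𝓖.G.mem_chart_source _)
    have h2 : SmoothFunAt (fun p : 𝓖.M => 𝓖.kerProj x (𝓖.G.coordChange (𝓖.one x) (𝓖.one p)
        (extField Y.1 (𝓖.one p)))) x :=
      (smoothFunAt_const (𝓖.kerProj x) (x : 𝓖.M)).clm_apply
        (SmoothFunAt.comp h1 (𝓖.smoothAt_one x))
    refine h2.congr_of_eventuallyEq ?_
    filter_upwards [U.isOpen.mem_nhds x.2] with p hp
    have h3 : extField Y.1 (𝓖.one p) = Y.1.1 (𝓖.oneInto ⟨p, hp⟩) := extendByZero_of_mem _ _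
    rw [h3, extendByZero_of_mem _ hp]
    rfl⟩

theorem restrictOne_rightExtSection (X : 𝓖.pullbackBundle.sections U) :
    restrictOne (rightExtSection X) = X :=
  Subtype.ext (funext fun x => Subtype.ext (rightExtSection_one X x))

/-- A right-invariant vector field is determined by its values at the identity arrows. -/
theorem rightExtSection_restrictOne (Y : 𝓖.rightInvariant U) :
    rightExtSection (restrictOne Y) = Y := by
  refine Subtype.ext (Subtype.ext (funext fun g => ?_))
  have hg : 𝓖.tgt g ∈ U := g.2
  have key : ∀ k : 𝓖.arrowsInto U, 𝓖.mul (𝓖.one (𝓖.tgt g)) g = k →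
      𝓖.rightTransl (𝓖.one (𝓖.tgt g)) g k (Y.1.1 (𝓖.oneInto ⟨_, hg⟩)) = Y.1.1 k := by
    intro k hk
    have hs : 𝓖.src (𝓖.oneInto (⟨𝓖.tgt g, hg⟩ : U)) = 𝓖.tgt g := 𝓖.toTop.src_one _
    obtain rfl : k = 𝓖.mulInto (𝓖.oneInto ⟨_, hg⟩) g hs := Subtype.ext hk.symm
    exact (Y.2.2 (𝓖.oneInto ⟨_, hg⟩) g hs).symm
  refine Eq.trans ?_ (key g (𝓖.toTop.one_mul g))
  have h : extSection (restrictOne Y) (𝓖.tgt g) = (restrictOne Y).1 ⟨_, hg⟩ :=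
    extendByZero_of_mem _ hg
  change 𝓖.rightTransl _ _ _ (Subtype.val (extSection (restrictOne Y) (𝓖.tgt g))) = _
  rw [h]
  rfl

variable (𝓖) in
/-- Sections over `U` are identified with right-invariant vector fields on `t⁻¹(U)`. -/
def rightExtEquiv (U : Opens 𝓖.M) : 𝓖.pullbackBundle.sections U ≃ₗ[ℝ] 𝓖.rightInvariant U :=
  LinearEquiv.symm
    { toFun := restrictOne
      invFun := rightExtSection
      map_add' := fun _ _ => rfl
      map_smul' := fun _ _ => rfl
      left_inv := rightExtSection_restrictOne
      right_inv := restrictOne_rightExtSection }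

theorem extField_mul (Y : 𝓖.rightInvariant U) {k l : 𝓖.G} (hk : k ∈ 𝓖.arrowsInto U)
    (hkl : 𝓖.src k = 𝓖.tgt l) :
    extField Y.1 (𝓖.mul k l) = 𝓖.tangentRightMul k l (extField Y.1 k) := by
  have h1 : extField Y.1 k = Y.1.1 ⟨k, hk⟩ := extendByZero_of_mem _ hk
  have h2 : extField Y.1 (𝓖.mul k l) = Y.1.1 (𝓖.mulInto ⟨k, hk⟩ l hkl) :=
    extendByZero_of_mem _ (𝓖.mulInto ⟨k, hk⟩ l hkl).2
  rw [h1, h2]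
  exact Y.2.2 ⟨k, hk⟩ l hkl

theorem extField_mem_kerTsrc (Y : 𝓖.rightInvariant U) {k : 𝓖.G} (hk : k ∈ 𝓖.arrowsInto U) :
    extField Y.1 k ∈ 𝓖.kerTsrc k := by
  have h : extField Y.1 k = Y.1.1 ⟨k, hk⟩ := extendByZero_of_mem _ hk
  rw [h]
  exact Y.2.1 ⟨k, hk⟩

/-- The Lie bracket of right-invariant vector fields. -/
def rightInvariantBracket (Y Z : 𝓖.rightInvariant U) : 𝓖.rightInvariant U :=
  ⟨sectionBracket Y.1 Z.1, by
    have hO : ∀ k ∈ 𝓖.arrowsInto U, (𝓖.arrowsInto U : Set 𝓖.G) ∈ 𝓝 k :=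
      fun k hk => (𝓖.arrowsInto U).isOpen.mem_nhds hk
    refine ⟨fun h => ?_, fun h g hg => ?_⟩
    · exact lieBracketAt_mem_kerTsrc (Y.1.2 h) (Z.1.2 h)
        (mem_of_superset (hO h h.2) fun _ hk => extField_mem_kerTsrc Y hk)
        (mem_of_superset (hO h h.2) fun _ hk => extField_mem_kerTsrc Z hk)
    · exact lieBracketAt_mul (𝓖.arrowsInto U).isOpen h.2 hg
        (fun k hk => Y.1.2 ⟨k, hk⟩) (fun k hk => Z.1.2 ⟨k, hk⟩)
        (Y.1.2 (𝓖.mulInto h g hg)) (Z.1.2 (𝓖.mulInto h g hg))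
        (fun k hk => extField_mem_kerTsrc Y hk) (fun k hk => extField_mem_kerTsrc Z hk)
        (fun k hk l hkl => extField_mul Y hk hkl) (fun k hk l hkl => extField_mul Z hk hkl)⟩

theorem rightInvariantBracket_add_left (X Y Z : 𝓖.rightInvariant U) :
    rightInvariantBracket (X + Y) Z = rightInvariantBracket X Z + rightInvariantBracket Y Z :=
  Subtype.ext (sectionBracket_add_left X.1 Y.1 Z.1)

theorem rightInvariantBracket_smul_left (c : ℝ) (X Y : 𝓖.rightInvariant U) :
    rightInvariantBracket (c • X) Y = c • rightInvariantBracket X Y :=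
  Subtype.ext (sectionBracket_smul_left c X.1 Y.1)

theorem rightInvariantBracket_add_right (X Y Z : 𝓖.rightInvariant U) :
    rightInvariantBracket X (Y + Z) = rightInvariantBracket X Y + rightInvariantBracket X Z :=
  Subtype.ext (sectionBracket_add_right X.1 Y.1 Z.1)

theorem rightInvariantBracket_smul_right (c : ℝ) (X Y : 𝓖.rightInvariant U) :
    rightInvariantBracket X (c • Y) = c • rightInvariantBracket X Y :=
  Subtype.ext (sectionBracket_smul_right c X.1 Y.1)

/-! ### The bracket of sections of the pullback bundle -/

variable (𝓖) in
/-- The bracket of sections over `U` that corresponds to the Lie bracket of right-invariant vector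
fields. -/
def algebroidBracket (U : Opens 𝓖.M) : 𝓖.pullbackBundle.sections U →ₗ[ℝ]
    𝓖.pullbackBundle.sections U →ₗ[ℝ] 𝓖.pullbackBundle.sections U :=
  LinearMap.mk₂ ℝ (fun X Y => restrictOne
      (rightInvariantBracket (𝓖.rightExtEquiv U X) (𝓖.rightExtEquiv U Y)))
    (fun X X' Y => by rw [map_add, rightInvariantBracket_add_left]; rfl)
    (fun c X Y => by rw [map_smul, rightInvariantBracket_smul_left]; rfl)
    (fun X Y Y' => by rw [map_add, rightInvariantBracket_add_right]; rfl)
    (fun c X Y => by rw [map_smul, rightInvariantBracket_smul_right]; rfl)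

theorem isRightInvariantBracket_algebroidBracket :
    𝓖.IsRightInvariantBracket 𝓖.pullbackBundle 𝓖.rightExtEquiv 𝓖.algebroidBracket :=
  fun U X Y g => congrArg (fun Z : 𝓖.rightInvariant U => Z.1.1 g)
    (rightExtSection_restrictOne
      (rightInvariantBracket (𝓖.rightExtEquiv U X) (𝓖.rightExtEquiv U Y)))

variable {br : ∀ U : Opens 𝓖.M, 𝓖.pullbackBundle.sections U →ₗ[ℝ]
  𝓖.pullbackBundle.sections U →ₗ[ℝ] 𝓖.pullbackBundle.sections U}

theorem IsRightInvariantBracket.rightExtEquiv_apply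
    (hbr : 𝓖.IsRightInvariantBracket 𝓖.pullbackBundle 𝓖.rightExtEquiv br)
    (X Y : 𝓖.pullbackBundle.sections U) :
    (𝓖.rightExtEquiv U (br U X Y)).1 =
      sectionBracket (𝓖.rightExtEquiv U X).1 (𝓖.rightExtEquiv U Y).1 :=
  Subtype.ext (funext (hbr U X Y))

theorem IsRightInvariantBracket.coe_apply
    (hbr : 𝓖.IsRightInvariantBracket 𝓖.pullbackBundle 𝓖.rightExtEquiv br)
    (X Y : 𝓖.pullbackBundle.sections U) (x : U) :
    ((br U X Y).1 x : 𝓖.G.TangentSp (𝓖.one x)) =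
      lieBracketAt (𝓖.rightExt (extSection X)) (𝓖.rightExt (extSection Y)) (𝓖.one x) := by
  rw [← extField_rightExtSection, ← extField_rightExtSection, ← rightExtSection_one]
  exact hbr U X Y (𝓖.oneInto x)

theorem section_eq_zero {X : 𝓖.pullbackBundle.sections U} (h : (𝓖.rightExtEquiv U X).1 = 0) :
    X = 0 :=
  (𝓖.rightExtEquiv U).map_eq_zero_iff.1 (Subtype.ext h)

theorem tgt_one_mem {x : 𝓖.M} (hx : x ∈ U) : 𝓖.tgt (𝓖.one x) ∈ U :=
  (congrArg (fun y => y ∈ U) (𝓖.toTop.tgt_one x)).mpr hx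

theorem rightExt_funSMul (f : U → ℝ) (hf : IsSmoothFun f) (X : 𝓖.pullbackBundle.sections U) :
    𝓖.rightExt (extSection (𝓖.pullbackBundle.funSMul f hf X)) =
      fun g => (extendByZero (A := fun _ => ℝ) (U : Set 𝓖.M) f ∘ 𝓖.tgt) g •
        𝓖.rightExt (extSection X) g := by
  funext g
  have h : extSection (𝓖.pullbackBundle.funSMul f hf X) (𝓖.tgt g) =
      extendByZero (A := fun _ => ℝ) (U : Set 𝓖.M) f (𝓖.tgt g) • extSection X (𝓖.tgt g) := by
    by_cases hg : 𝓖.tgt g ∈ (U : Set 𝓖.M) <;>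
      simp [extSection, extendByZero, hg, BanachBundle.funSMul]
  rw [rightExt, h]
  exact map_smul _ _ _

theorem IsRightInvariantBracket.leibniz
    (hbr : 𝓖.IsRightInvariantBracket 𝓖.pullbackBundle 𝓖.rightExtEquiv br)
    (f : U → ℝ) (hf : IsSmoothFun f) (X Y : 𝓖.pullbackBundle.sections U) (x : U) :
    (br U X (𝓖.pullbackBundle.funSMul f hf Y)).1 x = f x • (br U X Y).1 x +
      differential (extendByZero (A := fun _ => ℝ) (U : Set 𝓖.M) f) (x : 𝓖.M)
        (𝓖.anchor x (X.1 x)) • Y.1 x := by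
  have hfx : SmoothFunAt (extendByZero (A := fun _ => ℝ) (U : Set 𝓖.M) f)
      (𝓖.tgt (𝓖.one x)) := hf ⟨_, tgt_one_mem x.2⟩
  have hX : 𝓖.rightExt (extSection X) (𝓖.one x) = (X.1 x : 𝓖.G.TangentSp (𝓖.one x)) :=
    rightExtSection_one X x
  have hY : 𝓖.rightExt (extSection Y) (𝓖.one x) = (Y.1 x : 𝓖.G.TangentSp (𝓖.one x)) :=
    rightExtSection_one Y x
  have hval : (extendByZero (A := fun _ => ℝ) (U : Set 𝓖.M) f ∘ 𝓖.tgt) (𝓖.one x) = f x :=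
    (congrArg (extendByZero (A := fun _ => ℝ) (U : Set 𝓖.M) f) (𝓖.toTop.tgt_one x)).trans
      (extendByZero_of_mem _ x.2)
  refine Subtype.ext ?_
  rw [hbr.coe_apply, rightExt_funSMul, lieBracketAt_funSMul_right
    (hfx.comp (𝓖.smoothAt_tgt _)) (smoothSectionAt_rightExt_extSection Y (tgt_one_mem x.2)),
    hX, hY, hval, differential_comp (hf x) (𝓖.smoothAt_tgt _) (𝓖.toTop.tgt_one x),
    ← hbr.coe_apply]
  rfl

theorem IsRightInvariantBracket.isLieBracket
    (hbr : 𝓖.IsRightInvariantBracket 𝓖.pullbackBundle 𝓖.rightExtEquiv br) (U : Opens 𝓖.M) :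
    𝓖.pullbackBundle.IsLieBracket 𝓖.anchor U (br U) where
  skew X Y := by
    refine (𝓖.rightExtEquiv U).injective (Subtype.ext ?_)
    rw [map_neg, hbr.rightExtEquiv_apply, sectionBracket_swap, ← hbr.rightExtEquiv_apply]
    rfl
  leibniz := hbr.leibniz
  jacobi X Y Z := by
    refine section_eq_zero ?_
    rw [map_add, map_add]
    change (𝓖.rightExtEquiv U _).1 + (𝓖.rightExtEquiv U _).1 + (𝓖.rightExtEquiv U _).1 = 0
    simp only [hbr.rightExtEquiv_apply]
    exact sectionBracket_jacobi _ _ _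

theorem IsRightInvariantBracket.restrict
    (hbr : 𝓖.IsRightInvariantBracket 𝓖.pullbackBundle 𝓖.rightExtEquiv br) (hVU : V ≤ U)
    (X Y : 𝓖.pullbackBundle.sections U) :
    br V (𝓖.pullbackBundle.restrict hVU X) (𝓖.pullbackBundle.restrict hVU Y) =
      𝓖.pullbackBundle.restrict hVU (br U X Y) := by
  have hext : ∀ (Z : 𝓖.pullbackBundle.sections U) (x : V), ∀ᶠ g in 𝓝 (𝓖.one x),
      𝓖.rightExt (extSection (𝓖.pullbackBundle.restrict hVU Z)) g =
        𝓖.rightExt (extSection Z) g := by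
    intro Z x
    filter_upwards [(𝓖.arrowsInto V).isOpen.mem_nhds (𝓖.oneInto x).2] with g hg
    refine rightExt_congr ?_
    have hgV : 𝓖.tgt g ∈ (V : Set 𝓖.M) := hg
    rw [extSection, extSection, extendByZero_of_mem _ hgV, extendByZero_of_mem _ (hVU hgV)]
    rfl
  refine Subtype.ext (funext fun x => Subtype.ext ?_)
  rw [hbr.coe_apply, lieBracketAt_congr (hext X x) (hext Y x)]
  exact (hbr.coe_apply X Y ⟨x, hVU x.2⟩).symm

theorem IsRightInvariantBracket.isLocalizedBy
    (hbr : 𝓖.IsRightInvariantBracket 𝓖.pullbackBundle 𝓖.rightExtEquiv br) :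
    𝓖.pullbackBundle.IsLocalizedBy 𝓖.anchor (br ⊤) br :=
  ⟨hbr.isLieBracket, rfl, fun _ _ hVU X Y => hbr.restrict hVU X Y⟩

theorem IsRightInvariantBracket.isLieMorphism
    (hbr : 𝓖.IsRightInvariantBracket 𝓖.pullbackBundle 𝓖.rightExtEquiv br) (U : Opens 𝓖.M) :
    𝓖.pullbackBundle.IsLieMorphism 𝓖.anchor U (br U) := by
  intro X Y x
  have hext : ∀ Z : 𝓖.pullbackBundle.sections U,
      extendByZero (A := 𝓖.M.TangentSp) (U : Set 𝓖.M) (fun y : U => 𝓖.anchor y (Z.1 y)) =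
        fun p => 𝓖.anchor p (extSection Z p) := by
    intro Z
    funext p
    by_cases hp : p ∈ (U : Set 𝓖.M) <;> simp [extSection, extendByZero, hp]
  have hsm : ∀ Z : 𝓖.pullbackBundle.sections U, 𝓖.M.tangentBundle.SmoothSectionAt
      (fun p => 𝓖.anchor p (extSection Z p)) (x : 𝓖.M) :=
    fun Z _ hx => 𝓖.isMorphism_anchor.smoothFunAt (Z.2 x) hx
  have h := tanMap_lieBracketAt (𝓖.smoothAt_tgt (𝓖.one x)) (𝓖.toTop.tgt_one x)
    (smoothSectionAt_rightExt_extSection X (tgt_one_mem x.2))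
    (smoothSectionAt_rightExt_extSection Y (tgt_one_mem x.2)) (hsm X) (hsm Y)
    (Eventually.of_forall fun g => tanMap_tgt_rightExt (extSection X) g)
    (Eventually.of_forall fun g => tanMap_tgt_rightExt (extSection Y) g)
  rw [NNHBanachManifold.lieBracket, hext, hext, ← h, ← hbr.coe_apply]
  rfl

end NNHBanachLieGroupoid

end

/-- For every not necessarily Hausdorff Banach-Lie groupoid, the pullback of `ker Ts` by the
identity section is a Banach bundle; over every open `U ⊆ M`, restriction to the identity arrows is
a linear isomorphism from the right-invariant vector fields on `t⁻¹(U)` onto the sections over `U`,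
with inverse `Φ U`; there is exactly one family of brackets with `Φ [X, Y] = [Φ X, Φ Y]`, and it
forms, with the anchor `Tt`, a Banach-Lie algebroid whose bracket is localized by the brackets over
the open subsets. -/
theorem theorem4p19 (𝓖 : NNHBanachLieGroupoid.{u, v, u', v'}) :
    ∃ 𝒜 : BanachBundle 𝓖.M 𝓖.AFiber, 𝓖.IsPullbackBundle 𝒜 ∧
      ∃ Φ : ∀ U : Opens 𝓖.M, 𝒜.sections U ≃ₗ[ℝ] 𝓖.rightInvariant U,
        (∀ (U : Opens 𝓖.M) (X : 𝒜.sections U) (x : U),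
          (Φ U X).1.1 (𝓖.oneInto x) = (X.1 x : 𝓖.G.TangentSp (𝓖.one x))) ∧
        (∃! br : ∀ U : Opens 𝓖.M, 𝒜.sections U →ₗ[ℝ] 𝒜.sections U →ₗ[ℝ] 𝒜.sections U,
          𝓖.IsRightInvariantBracket 𝒜 Φ br) ∧
        ∀ br : ∀ U : Opens 𝓖.M, 𝒜.sections U →ₗ[ℝ] 𝒜.sections U →ₗ[ℝ] 𝒜.sections U,
          𝓖.IsRightInvariantBracket 𝒜 Φ br →
            𝒜.IsBanachLieAlgebroid 𝓖.anchor (br ⊤) ∧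
            𝒜.IsLocalizedBy 𝓖.anchor (br ⊤) br ∧
            ∀ U : Opens 𝓖.M, 𝒜.IsLieMorphism 𝓖.anchor U (br U) := by
  refine ⟨𝓖.pullbackBundle, 𝓖.isPullbackBundle_pullbackBundle, 𝓖.rightExtEquiv,
    fun U X x => NNHBanachLieGroupoid.rightExtSection_one X x, ⟨𝓖.algebroidBracket,
      NNHBanachLieGroupoid.isRightInvariantBracket_algebroidBracket, fun br hbr => ?_⟩,
    fun br hbr => ⟨⟨𝓖.isMorphism_anchor, hbr.isLieBracket ⊤, ⟨br, hbr.isLocalizedBy⟩,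
      hbr.isLieMorphism ⊤⟩, hbr.isLocalizedBy, hbr.isLieMorphism⟩⟩
  funext U
  refine LinearMap.ext fun X => LinearMap.ext fun Y => (𝓖.rightExtEquiv U).injective
    (Subtype.ext ?_)
  rw [hbr.rightExtEquiv_apply,
    NNHBanachLieGroupoid.isRightInvariantBracket_algebroidBracket.rightExtEquiv_apply]
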